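/- **Setting.** Let $d\ge 2$ and let $\Gamma\subset\mathbb R^d$ be a smooth, closed (compact, without boundary), connected, embedded hypersurface with surface measure $\mathcal H^{d-1}$. Let $m,n,A,\tau:[-1,1]\to\mathbb R$ be such that * $m(u)=(1-u^2)^i\,\tilde m(u)$ for some integer $i\ge 0$ and some $\tilde m\in C^\infty([-1,1])$ with $\min\tilde m>0$; * $n,A,\tau\in C^\infty([-1,1])$, $n\neq0$ and $n'\ne0$ a.e., $A^2\tau>0$ on $(-1,1)$, and $\inf_{(-1,1)}\frac{n^2}{A^2\tau\sqrt{1-u^2}}>0$; * $n$ vanishes at most to finite order at $\pm1$: $|n(u)|\ge b(1-u^2)^N$ on $[-1,1]$ for some $b>0$, $N\ge0$ (e.g. $\min|n|>0$). Put $\mathsf a=\frac{1}{A^2\tau}\big(\frac{n^2}{n'}\big)^2\frac1{\sqrt{1-u^2}}$, $\mathsf m=\frac{m}{\sqrt{1-u^2}}$, $\sigma=\int_{-1}^1\sqrt{1-u^2}\,du$, and $\mathcal C f(s)=\int_{-1}^1\big(f+\frac n{n'}\partial_uf\big)(s,u)\,du$. Let $H$ be the completion of $\{f\in C^\infty(\Gamma\times[-1,1]):\sqrt{\mathsf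 a}\,\partial_uf\in L^2(\Gamma\times[-1,1]),\ \mathcal Cf\in H^1(\Gamma)\}$ with respect to the inner product $(f,g)_{\mathcal E}+(\mathcal Cf,\mathcal Cg)_{H^1(\Gamma)}$, where $$(f,g)_{\mathcal E}=\int_\Gamma\int_{-1}^1\big(\mathsf a\,\partial_uf\,\partial_ug+\mathsf m\,\nabla_\Gamma f\cdot\nabla_\Gamma g\big)\,du\,d\mathcal H^{d-1}.$$ For $\kappa\in H^1(\Gamma)$ consider the problem of finding $(f,V)\in H\times H^1(\Gamma)^*$ with $$\mathcal Cf=\sigma\kappa,\qquad (f,\varphi)_{\mathcal E}=\langle V,\mathcal C\varphi\rangle\quad\text{for all }\varphi\in H. \tag{P}$$ Let $\{e_k\}_{k\in\mathbb N}\subset H^1(\Gamma)$ be an orthonormal basis of $\dot L^2(\Gamma)=\{h\in L^2(\Gamma):\int_\Gamma h=0\}$ with $-\Delta_\Gamma e_k=\lambda_ke_k$ (i.e. $\int_\Gamma\nabla_\Gamma e_k\cdot\nabla_\Gamma\psi=\lambda_k\int_\Gamma e_k\psi$ for all $\psi\in H^1(\Gamma)$), where the eigenvalues, listed with multiplicity,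 satisfy $0<\lambda_1\le\lambda_2\le\dots$ and $\lambda_k\to\infty$. Put $\Lambda=\{\lambda_k:k\in\mathbb N\}$. **Lemma.** For each $\kappa\in H^1(\Gamma)$, (P) has a unique solution, which is denoted by $(\mathcal F\kappa,\mathcal G_\Gamma\kappa)$, and each element of $H$ is realised by a unique function in $L^2(\Gamma\times[-1,1])$: there is exactly one $g\in L^2(\Gamma\times[-1,1])$ for which some sequence of smooth functions in the space above converges to the element in $H$ and to $g$ in $L^2$. Moreover: 1. For all $k\ne l$, $(\mathcal Fe_k,e_l)_{L^2(\Gamma)}=0$ a.e. in $(-1,1)$. 2. There is a function $\zeta:\Lambda\to(0,\infty)$ such that for every $h=\sum_kh_ke_k$ with $\sum_k\lambda_k^2h_k^2<\infty$ (that is, $h\in\dot H^2(\Gamma)$; the series then converges in $H^1(\Gamma)$) $$\mathcal G_\Gamma h=\sum_k\zeta(\lambda_k)\,h_k\,e_k ,$$ where the series converges in $L^2(\Gamma)$ and its sum is identified with the functional $\psi\mapsto(\,\cdot\,,\psi)_{L^2(\Gamma)}$ on $H^1(\Gamma)$. The function $\zeta$ is unique, and it is given by $$\zeta(\lambda_k)=\langle\mathcal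 G_\Gamma e_k,e_k\rangle=\tfrac12\lambda_k\int_{-1}^1\mathsf m\,f_k\,du,\qquad f_k:=(\mathcal Fe_k,e_k)_{L^2(\Gamma)},$$ where $\mathsf m f_k$ is integrable on $(-1,1)$. -/

import Mathlib

open MeasureTheory Set Filter Topology
open scoped ContDiff InnerProductSpace

noncomputable section

namespace PropagationOperator

/-! ### Closed hypersurfaces of Euclidean space -/

/-- The Euclidean space `ℝ^d`. -/
abbrev Eu (d : ℕ) := EuclideanSpace ℝ (Fin d)

/-- A smooth, closed (compact, without boundary), connected, embedded hypersurface of `ℝ^d`: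
near each of its points a smooth diffeomorphism between open subsets of `ℝ^d` maps it
onto a piece of a coordinate hyperplane. -/
structure IsClosedHypersurface {d : ℕ} (Γ : Set (Eu d)) : Prop where
  isCompact : IsCompact Γ
  isConnected : IsConnected Γ
  exists_chart : ∀ x ∈ Γ, ∃ (Φ : OpenPartialHomeomorph (Eu d) (Eu d)) (j : Fin d),
    x ∈ Φ.source ∧ ContDiffOn ℝ ∞ Φ Φ.source ∧ ContDiffOn ℝ ∞ Φ.symm Φ.target ∧
      ∀ y ∈ Φ.source, (y ∈ Γ ↔ Φ y j = 0)

/-- The surface measure: the (Euclidean) `(d-1)`-dimensional Hausdorff measure on `Γ`. -/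
def surfaceMeasure {d : ℕ} (Γ : Set (Eu d)) : Measure (Eu d) :=
  (Measure.euclideanHausdorffMeasure (d - 1)).restrict Γ

/-- The tangent space `T_x Γ`, as a linear subspace of `ℝ^d`. -/
def tangentSpace {d : ℕ} (Γ : Set (Eu d)) (x : Eu d) : Submodule ℝ (Eu d) :=
  Submodule.span ℝ (tangentConeAt ℝ Γ x)

/-- The surface gradient `∇_Γ g` of (the restriction to `Γ` of) a smooth function `g` on `ℝ^d`:
the orthogonal projection of the gradient onto the tangent space. -/
def surfaceGradient {d : ℕ} (Γ : Set (Eu d)) (g : Eu d → ℝ) (x : Eu d) : Eu d :=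
  (tangentSpace Γ x).starProjection (gradient g x)

/-! ### `L²(Γ)`, `H¹(Γ)` and the Laplace--Beltrami operator -/

/-- `L²(Γ)`. -/
abbrev L2 {d : ℕ} (Γ : Set (Eu d)) := Lp ℝ 2 (surfaceMeasure Γ)

/-- Square-integrable `ℝ^d`-valued fields on `Γ`. -/
abbrev L2Vec {d : ℕ} (Γ : Set (Eu d)) := Lp (Eu d) 2 (surfaceMeasure Γ)

/-- The Sobolev space `H¹(Γ)`: the completion of `C^∞(Γ)` for the norm
`‖g‖² = ‖g‖²_{L²} + ‖∇_Γ g‖²_{L²}`, realised as the closure of the set of pairs `(g, ∇_Γ g)`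
in `L²(Γ) × L²(Γ; ℝ^d)`. Smooth functions on the compact set `Γ` are the restrictions of
smooth functions on `ℝ^d`. -/
def H1 {d : ℕ} (Γ : Set (Eu d)) : Submodule ℝ (WithLp 2 (L2 Γ × L2Vec Γ)) :=
  (Submodule.span ℝ {x | ∃ g : Eu d → ℝ, ContDiff ℝ ∞ g ∧
    x.fst =ᵐ[surfaceMeasure Γ] g ∧
    x.snd =ᵐ[surfaceMeasure Γ] surfaceGradient Γ g}).topologicalClosure

/-- The function underlying an element of `H¹(Γ)`. -/
def h1val {d : ℕ} {Γ : Set (Eu d)} (h : H1 Γ) : L2 Γ := (h : WithLp 2 (L2 Γ × L2Vec Γ)).fst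

/-- The surface gradient of an element of `H¹(Γ)`. -/
def h1grad {d : ℕ} {Γ : Set (Eu d)} (h : H1 Γ) : L2Vec Γ :=
  (h : WithLp 2 (L2 Γ × L2Vec Γ)).snd

/-- `h ∈ H¹(Γ)` lies in the domain of the (self-adjoint) minus Laplace--Beltrami operator of
`L²(Γ)` and `-Δ_Γ h = g`. -/
def IsNegLaplacian {d : ℕ} {Γ : Set (Eu d)} (h : H1 Γ) (g : L2 Γ) : Prop :=
  ∀ ψ : H1 Γ, ⟪h1grad h, h1grad ψ⟫_ℝ = ⟪g, h1val ψ⟫_ℝ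

/-- `(e_k)` is an orthonormal basis of the space of square-integrable functions with zero
average, `-Δ_Γ e_k = lam_k e_k`, and `0 < lam_0 ≤ lam_1 ≤ ⋯ → ∞`. -/
structure IsEigenbasis {d : ℕ} {Γ : Set (Eu d)} (e : ℕ → H1 Γ) (lam : ℕ → ℝ) : Prop where
  orthonormal : Orthonormal ℝ (fun k => h1val (e k))
  complete : ∀ h : L2 Γ,
    h ∈ (Submodule.span ℝ (range fun k => h1val (e k))).topologicalClosure ↔
      ∫ s, h s ∂(surfaceMeasure Γ) = 0
  eigen : ∀ k, IsNegLaplacian (e k) (lam k • h1val (e k))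
  pos : ∀ k, 0 < lam k
  mono : Monotone lam
  tendsto : Tendsto lam atTop atTop

/-! ### The coefficients -/

/-- The coefficient functions `m, n, A, τ` (only their values on `[-1,1]` matter). -/
structure Coefficients where
  m : ℝ → ℝ
  n : ℝ → ℝ
  A : ℝ → ℝ
  tau : ℝ → ℝ

namespace Coefficients

variable (c : Coefficients)

/-- The derivative `n'` on `[-1,1]`. -/
def dn (u : ℝ) : ℝ := derivWithin c.n (Icc (-1) 1) u

/-- `𝖺 = (1 / (A²τ)) (n² / n')² / √(1-u²)`. -/
def sa (u : ℝ) : ℝ :=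
  1 / (c.A u ^ 2 * c.tau u) * (c.n u ^ 2 / c.dn u) ^ 2 * (1 / √(1 - u ^ 2))

/-- `𝗆 = m / √(1-u²)`. -/
def sm (u : ℝ) : ℝ := c.m u / √(1 - u ^ 2)

/-- The hypotheses on the coefficients. -/
structure Admissible : Prop where
  /-- `m = (1-u²)^i m̃` with `m̃` smooth and positive on `[-1,1]` -/
  m_form : ∃ (i : ℕ) (mt : ℝ → ℝ), ContDiffOn ℝ ∞ mt (Icc (-1) 1) ∧
    (∀ u ∈ Icc (-1 : ℝ) 1, 0 < mt u) ∧ ∀ u ∈ Icc (-1 : ℝ) 1, c.m u = (1 - u ^ 2) ^ i * mt u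
  n_smooth : ContDiffOn ℝ ∞ c.n (Icc (-1) 1)
  A_smooth : ContDiffOn ℝ ∞ c.A (Icc (-1) 1)
  tau_smooth : ContDiffOn ℝ ∞ c.tau (Icc (-1) 1)
  n_ne_zero : ∀ᵐ u ∂(volume.restrict (Icc (-1 : ℝ) 1)), c.n u ≠ 0 ∧ c.dn u ≠ 0
  A_tau_pos : ∀ u ∈ Ioo (-1 : ℝ) 1, 0 < c.A u ^ 2 * c.tau u
  lower_bound : ∃ ι : ℝ, 0 < ι ∧ ∀ u ∈ Ioo (-1 : ℝ) 1,
    ι ≤ c.n u ^ 2 / (c.A u ^ 2 * c.tau u * √(1 - u ^ 2))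
  /-- `n` does not vanish to infinite order at `±1` -/
  finite_order : ∃ (N : ℕ) (b : ℝ), 0 < b ∧ ∀ u ∈ Icc (-1 : ℝ) 1, b * (1 - u ^ 2) ^ N ≤ |c.n u|

end Coefficients

/-- `σ = ∫_{-1}^1 √(1-u²) du`. -/
def sigma : ℝ := ∫ u in (-1 : ℝ)..1, √(1 - u ^ 2)

/-! ### The energy space `H` -/

/-- The product measure on `Γ × [-1,1]`. -/
def cylMeasure {d : ℕ} (Γ : Set (Eu d)) : Measure (Eu d × ℝ) :=
  (surfaceMeasure Γ).prod (volume.restrict (Icc (-1) 1))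

/-- `L²(Γ × [-1,1])`. -/
abbrev CylL2 {d : ℕ} (Γ : Set (Eu d)) := Lp ℝ 2 (cylMeasure Γ)

/-- Square-integrable `ℝ^d`-valued fields on `Γ × [-1,1]`. -/
abbrev CylL2Vec {d : ℕ} (Γ : Set (Eu d)) := Lp (Eu d) 2 (cylMeasure Γ)

/-- The Hilbert space in which the triples `(√𝖺 ∂_u f, √𝗆 ∇_Γ f, 𝒞 f)` live. -/
abbrev Ambient {d : ℕ} (Γ : Set (Eu d)) :=
  WithLp 2 (CylL2 Γ × WithLp 2 (CylL2Vec Γ × H1 Γ))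

variable {d : ℕ} (Γ : Set (Eu d)) (c : Coefficients)

/-- `𝒞 f (s) = ∫_{-1}^1 (f + (n/n') ∂_u f)(s,u) du` for smooth `f`. -/
def constraintFun (f : Eu d × ℝ → ℝ) (s : Eu d) : ℝ :=
  ∫ u in (-1 : ℝ)..1, (f (s, u) + c.n u / c.dn u * deriv (fun v => f (s, v)) u)

/-- `f` is smooth on `Γ × [-1,1]` with `√𝖺 ∂_u f ∈ L²` and `𝒞 f ∈ H¹(Γ)`, and `x` is the triple
`(√𝖺 ∂_u f, √𝗆 ∇_Γ f, 𝒞 f)`. -/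
def IsSmoothElement (f : Eu d × ℝ → ℝ) (x : Ambient Γ) : Prop :=
  ContDiff ℝ ∞ f ∧
  x.fst =ᵐ[cylMeasure Γ] (fun p => √(c.sa p.2) * deriv (fun v => f (p.1, v)) p.2) ∧
  x.snd.fst =ᵐ[cylMeasure Γ]
    (fun p => √(c.sm p.2) • surfaceGradient Γ (fun s => f (s, p.2)) p.1) ∧
  h1val x.snd.snd =ᵐ[surfaceMeasure Γ] constraintFun c f

/-- The Hilbert space `H`, the completion of the space of smooth `f` on `Γ × [-1,1]` with
`√𝖺 ∂_u f ∈ L²`, `𝒞 f ∈ H¹(Γ)`, for the inner product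
`(f,g)_H = ∫∫ (𝖺 ∂_u f ∂_u g + 𝗆 ∇_Γ f · ∇_Γ g) + (𝒞 f, 𝒞 g)_{H¹}`. The map
`f ↦ (√𝖺 ∂_u f, √𝗆 ∇_Γ f, 𝒞 f)` is isometric for it, so `H` is the closure of its image. -/
def EnergySpace : Submodule ℝ (Ambient Γ) :=
  (Submodule.span ℝ {x | ∃ f, IsSmoothElement Γ c f x}).topologicalClosure

variable {Γ c}

/-- The continuous extension `𝒞 : H → H¹(Γ)`. -/
def constraint (f : EnergySpace Γ c) : H1 Γ := (f : Ambient Γ).snd.snd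

/-- The bilinear form `(f,g)_ℰ = ∫∫ (𝖺 ∂_u f ∂_u g + 𝗆 ∇_Γ f · ∇_Γ g)` on `H`. -/
def energyForm (f g : EnergySpace Γ c) : ℝ :=
  ⟪(f : Ambient Γ).fst, (g : Ambient Γ).fst⟫_ℝ +
    ⟪(f : Ambient Γ).snd.fst, (g : Ambient Γ).snd.fst⟫_ℝ

/-- `g ∈ L²(Γ × [-1,1])` is the function on `Γ × [-1,1]` that `f ∈ H` stands for: some smooth
functions converge to `f` in `H` and to `g` in `L²`. -/
def IsRealisation (f : EnergySpace Γ c) (g : CylL2 Γ) : Prop :=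
  ((f : Ambient Γ), g) ∈ closure {z : Ambient Γ × CylL2 Γ |
    ∃ φ, IsSmoothElement Γ c φ z.1 ∧ z.2 =ᵐ[cylMeasure Γ] φ}

/-- The function on `Γ × [-1,1]` that `f ∈ H` stands for. -/
def realisation (f : EnergySpace Γ c) : CylL2 Γ := Classical.epsilon (IsRealisation f)

/-! ### The constrained elliptic problem and the propagation operator -/

/-- `(f, V) ∈ H × H¹(Γ)*` solves the constrained problem with datum `κ`:
`𝒞 f = σ κ` and `(f,φ)_ℰ = ⟨V, 𝒞 φ⟩` for all `φ ∈ H`. -/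
def IsSolution (κ : H1 Γ) (p : EnergySpace Γ c × StrongDual ℝ (H1 Γ)) : Prop :=
  constraint p.1 = sigma • κ ∧ ∀ φ : EnergySpace Γ c, energyForm p.1 φ = p.2 (constraint φ)

variable (c)

/-- The first component `ℱ` of the solution operator. -/
def solF (κ : H1 Γ) : EnergySpace Γ c := (Classical.epsilon (IsSolution (c := c) κ)).1

/-- The second component of the solution operator: the propagation operator `𝒢_Γ`. -/
def propagation (κ : H1 Γ) : StrongDual ℝ (H1 Γ) :=
  (Classical.epsilon (IsSolution (c := c) κ)).2

/-- The function `u ↦ (ℱκ, h)_{L²(Γ)}` on `(-1,1)`. -/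
def coeffF (κ h : H1 Γ) (u : ℝ) : ℝ :=
  ∫ s, realisation (solF c κ) (s, u) * h1val h s ∂(surfaceMeasure Γ)

/-- `𝒢_Γ h = ∑ ζ(lam_k) h_k e_k` for all `h = ∑ h_k e_k` with `∑ lam_k² h_k² < ∞`: such a series
converges in `H¹(Γ)`, say to `h`, and the functional `𝒢_Γ h` is represented by the `L²`-function
`∑ ζ(lam_k) h_k e_k`, a series that converges in `L²(Γ)`. -/
def IsSpectralSymbol (e : ℕ → H1 Γ) (lam : ℕ → ℝ) (ζ : range lam → ℝ) : Prop :=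
  ∀ a : ℕ → ℝ, Summable (fun k => lam k ^ 2 * a k ^ 2) →
    ∃ h : H1 Γ, HasSum (fun k => a k • e k) h ∧
      ∃ g : L2 Γ, HasSum (fun k => (ζ ⟨lam k, mem_range_self k⟩ * a k) • h1val (e k)) g ∧
        ∀ ψ : H1 Γ, propagation c h ψ = ⟪g, h1val ψ⟫_ℝ

end PropagationOperator

end

noncomputable section

namespace PropagationOperator

/-! ### Tensor products of square-integrable functions -/

/-! The constraint has a bounded right inverse, the lift of h to the function h/2 that is constant
in u, and on its kernel the energy form is the full inner product of H. So (P) is solved by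
subtracting from the lift its orthogonal projection onto the kernel (`exists_constrained_solver`),
and V is read off by testing with ψ/2 (`IsSolution.snd_apply`).

Elements of H are functions because of a Poincaré inequality in u (`Coefficients.poincare`).
Finite-order vanishing of n gives (1-u²)|n'| ≤ K|n|, so Hardy's inequality controls φ - φ(0) by
(n/n')φ', which √𝖺 φ' dominates; the constraint then controls φ(0).

The spectral part is separation of variables. Let e, e' be eigenfunctions with the same eigenvalue
l, e normalised. Replacing the e-component φ ⊗ e of an element by φ ⊗ e' (`transfer`) maps H to H:
the average of a smooth f against e is smooth in u, and the eigenvalue equation turns the pairing of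
∇_Γ f with ∇_Γ e into l times this average. For the energy form its adjoint is the transfer with e
and e' exchanged. Hence it carries the solution with datum e to the solution with datum e', with
multiplier ⟨𝒢e, e⟩ (e', ·) (`exists_transfer_isSolution`). The case e' = e gives ℱe = φ ⊗ e, hence
orthogonality; general e' shows that ⟨𝒢e, e⟩ depends on l alone, so ζ is well defined.

Testing with e/2 gives the formula for ζ. Testing with the solution itself shows that its energy is
σ ζ. This forces ζ > 0, since zero energy would kill the e-coefficient of the constraint, and with
Cauchy–Schwarz it gives ζ(λ) ≤ Cλ. The linear bound makes the series converge in L²(Γ), and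
continuity of κ ↦ ⟨𝒢κ, ψ⟩ permits summation term by term. -/

theorem ae_prod_of_ae_left {X Y : Type*} [MeasurableSpace X] [MeasurableSpace Y] {μ : Measure X}
    {ν : Measure Y} {p : X → Prop} (h : ∀ᵐ x ∂μ, p x) :
    ∀ᵐ z ∂(μ.prod ν), p z.1 :=
  Measure.quasiMeasurePreserving_fst.ae h

theorem ae_prod_of_ae_right {X Y : Type*} [MeasurableSpace X] [MeasurableSpace Y] {μ : Measure X}
    {ν : Measure Y} {p : Y → Prop} (h : ∀ᵐ y ∂ν, p y) :
    ∀ᵐ z ∂(μ.prod ν), p z.2 :=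
  Measure.quasiMeasurePreserving_snd.ae h

section Tensor

variable {X Y : Type*} [MeasurableSpace X] [MeasurableSpace Y] {μ : Measure X} {ν : Measure Y}
  {E : Type*} [NormedAddCommGroup E] [InnerProductSpace ℝ E]

theorem memLp_tensor {b : X → E} {p : Y → ℝ} (hb : MemLp b 2 μ) (hp : MemLp p 2 ν) :
    MemLp (fun z : X × Y => p z.2 • b z.1) 2 (μ.prod ν) := by
  refine (memLp_two_iff_integrable_sq_norm (f := fun z : X × Y => p z.2 • b z.1)
    (hp.1.comp_snd.smul hb.1.comp_fst)).2 ?_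
  have h1 := (memLp_two_iff_integrable_sq_norm hb.1).1 hb
  have h2 := (memLp_two_iff_integrable_sq_norm hp.1).1 hp
  refine (h1.mul_prod h2).congr (Eventually.of_forall fun z => ?_)
  simp only [norm_smul]
  ring

/-- The function `(s, u) ↦ p u • b s` as an element of `L²`. -/
def tensAux (b : Lp E 2 μ) (p : Lp ℝ 2 ν) : Lp E 2 (μ.prod ν) :=
  (memLp_tensor (Lp.memLp b) (Lp.memLp p)).toLp _

theorem tensAux_coe (b : Lp E 2 μ) (p : Lp ℝ 2 ν) :
    tensAux b p =ᵐ[μ.prod ν] fun z => p z.2 • b z.1 :=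
  MemLp.coeFn_toLp _

variable [IsFiniteMeasure μ] [IsFiniteMeasure ν]

theorem ae_ae_of_ae_prod_swap {p : X × Y → Prop} (h : ∀ᵐ z ∂(μ.prod ν), p z) :
    ∀ᵐ y ∂ν, ∀ᵐ x ∂μ, p (x, y) := by
  have h' : ∀ᵐ z ∂(ν.prod μ), p z.swap := by
    rw [← Measure.prod_swap] at h
    exact ae_of_ae_map measurable_swap.aemeasurable h
  exact Measure.ae_ae_of_ae_prod h'

theorem tensAux_inner (b b' : Lp E 2 μ) (p p' : Lp ℝ 2 ν) :
    ⟪tensAux b p, tensAux b' p'⟫_ℝ = ⟪b, b'⟫_ℝ * ⟪p, p'⟫_ℝ := by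
  rw [L2.inner_def, L2.inner_def, L2.inner_def, ← integral_prod_mul]
  refine integral_congr_ae ?_
  filter_upwards [tensAux_coe b p, tensAux_coe b' p'] with z h1 h2
  rw [h1, h2]
  simp only [real_inner_smul_left, real_inner_smul_right, Real.inner_apply]
  ring

theorem tensAux_norm (b : Lp E 2 μ) (p : Lp ℝ 2 ν) : ‖tensAux b p‖ = ‖b‖ * ‖p‖ := by
  have h := tensAux_inner b b p p
  simp only [real_inner_self_eq_norm_sq] at h
  rw [← mul_pow] at h
  exact (sq_eq_sq₀ (norm_nonneg _) (by positivity)).1 h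

variable (μ ν E) in
/-- The continuous bilinear map `(b, p) ↦ b ⊗ p`, `(b ⊗ p) (s, u) = p u • b s`. -/
def tens : Lp E 2 μ →L[ℝ] Lp ℝ 2 ν →L[ℝ] Lp E 2 (μ.prod ν) :=
  LinearMap.mkContinuous₂
    (LinearMap.mk₂ ℝ tensAux
      (fun b b' p => by
        ext1
        filter_upwards [tensAux_coe (b + b') p, tensAux_coe b p, tensAux_coe b' p,
          Lp.coeFn_add (tensAux b p) (tensAux b' p),
          ae_prod_of_ae_left (ν := ν) (Lp.coeFn_add b b')] with z h1 h2 h3 h4 h5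
        simp only [h1, h2, h3, h4, h5, Pi.add_apply, smul_add])
      (fun r b p => by
        ext1
        filter_upwards [tensAux_coe (r • b) p, tensAux_coe b p,
          Lp.coeFn_smul r (tensAux b p),
          ae_prod_of_ae_left (ν := ν) (Lp.coeFn_smul r b)] with z h1 h2 h4 h5
        simp only [h1, h2, h4, h5, Pi.smul_apply, smul_comm r])
      (fun b p p' => by
        ext1
        filter_upwards [tensAux_coe b (p + p'), tensAux_coe b p, tensAux_coe b p',
          Lp.coeFn_add (tensAux b p) (tensAux b p'),
          ae_prod_of_ae_right (μ := μ) (Lp.coeFn_add p p')] with z h1 h2 h3 h4 h5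
        simp only [h1, h2, h3, h4, h5, Pi.add_apply, add_smul])
      (fun r b p => by
        ext1
        filter_upwards [tensAux_coe b (r • p), tensAux_coe b p,
          Lp.coeFn_smul r (tensAux b p),
          ae_prod_of_ae_right (μ := μ) (Lp.coeFn_smul r p)] with z h1 h2 h4 h5
        simp only [h1, h2, h4, h5, Pi.smul_apply, smul_assoc]))
    1 (fun b p => by simp [tensAux_norm])

theorem tens_coe (b : Lp E 2 μ) (p : Lp ℝ 2 ν) :
    tens μ ν E b p =ᵐ[μ.prod ν] fun z => p z.2 • b z.1 :=
  tensAux_coe b p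

theorem tens_inner (b b' : Lp E 2 μ) (p p' : Lp ℝ 2 ν) :
    ⟪tens μ ν E b p, tens μ ν E b' p'⟫_ℝ = ⟪b, b'⟫_ℝ * ⟪p, p'⟫_ℝ :=
  tensAux_inner b b' p p'

theorem integrable_inner_section (b : Lp E 2 μ) (G : Lp E 2 (μ.prod ν)) :
    Integrable (fun z : X × Y => ⟪b z.1, G z⟫_ℝ) (μ.prod ν) := by
  have h := L2.integrable_inner (𝕜 := ℝ) (tens μ ν E b (indicatorConstLp 2 MeasurableSet.univ
    (measure_ne_top ν univ) (1 : ℝ))) G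
  refine h.congr ?_
  filter_upwards [tens_coe b (indicatorConstLp 2 MeasurableSet.univ
    (measure_ne_top ν univ) (1 : ℝ)), ae_prod_of_ae_right (μ := μ) (indicatorConstLp_coeFn
      (p := 2) (hs := MeasurableSet.univ) (hμs := measure_ne_top ν univ) (c := (1 : ℝ)))]
    with z h1 h2
  rw [h1, h2]
  simp

variable [CompleteSpace E]

/-- The partial inner product `G ↦ ∫ ⟪b s, G (s, ·)⟫ dμ(s)`, defined as the adjoint of `b ⊗ ·`. -/
def partialInner (b : Lp E 2 μ) : Lp E 2 (μ.prod ν) →L[ℝ] Lp ℝ 2 ν :=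
  ContinuousLinearMap.adjoint (tens μ ν E b)

theorem inner_partialInner (b : Lp E 2 μ) (G : Lp E 2 (μ.prod ν)) (p : Lp ℝ 2 ν) :
    ⟪partialInner b G, p⟫_ℝ = ⟪G, tens μ ν E b p⟫_ℝ :=
  ContinuousLinearMap.adjoint_inner_left _ _ _

theorem partialInner_inner (b : Lp E 2 μ) (G : Lp E 2 (μ.prod ν)) (p : Lp ℝ 2 ν) :
    ⟪p, partialInner b G⟫_ℝ = ⟪tens μ ν E b p, G⟫_ℝ :=
  ContinuousLinearMap.adjoint_inner_right _ _ _

theorem partialInner_tens (b b' : Lp E 2 μ) (p : Lp ℝ 2 ν) :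
    partialInner b (tens μ ν E b' p) = ⟪b, b'⟫_ℝ • p := by
  refine ext_inner_left ℝ fun q => ?_
  rw [partialInner_inner, tens_inner, real_inner_smul_right]

/-- Testing the adjoint relation with indicators and applying Fubini identifies the abstract adjoint
with the slicewise integral. -/
theorem partialInner_coe (b : Lp E 2 μ) (G : Lp E 2 (μ.prod ν)) :
    partialInner b G =ᵐ[ν] fun u => ∫ s, ⟪b s, G (s, u)⟫_ℝ ∂μ := by
  have hint := integrable_inner_section b G
  refine Integrable.ae_eq_of_forall_setIntegral_eq _ _
    ((Lp.memLp _).integrable (by norm_num)) hint.integral_prod_right fun A hA _ => ?_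
  have h1 := partialInner_inner b G (indicatorConstLp 2 hA (measure_ne_top ν A) (1 : ℝ))
  rw [L2.inner_indicatorConstLp_one, L2.inner_def] at h1
  rw [h1, ← integral_indicator hA]
  have h2 : ∀ᵐ z ∂(μ.prod ν), ⟪tens μ ν E b (indicatorConstLp 2 hA (measure_ne_top ν A) (1 : ℝ)) z,
      G z⟫_ℝ = A.indicator (fun _ => (1 : ℝ)) z.2 * ⟪b z.1, G z⟫_ℝ := by
    filter_upwards [tens_coe b (indicatorConstLp 2 hA (measure_ne_top ν A) (1 : ℝ)),
      ae_prod_of_ae_right (μ := μ) (indicatorConstLp_coeFn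
      (p := 2) (hs := hA) (hμs := measure_ne_top ν A) (c := (1 : ℝ)))] with z h1 h2
    rw [h1, h2, real_inner_smul_left]
  rw [integral_congr_ae h2, integral_prod_symm]
  · refine integral_congr_ae (Eventually.of_forall fun u => ?_)
    simp only
    rw [integral_const_mul]
    by_cases hu : u ∈ A <;> simp [hu]
  · exact (L2.integrable_inner (𝕜 := ℝ) _ G).congr h2

end Tensor

/-! ### Finiteness of the surface measure -/

/-- The parametrisation of the coordinate hyperplane `{y | y j = 0}`. -/
def hyperplaneMap {m : ℕ} (j : Fin (m + 1)) : (Fin m → ℝ) →ₗ[ℝ] Eu (m + 1) where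
  toFun v := WithLp.toLp 2 (Fin.insertNth (α := fun _ => ℝ) j 0 v)
  map_add' v w := by
    ext i
    refine Fin.succAboveCases j ?_ (fun i => ?_) i <;> simp
  map_smul' r v := by
    ext i
    refine Fin.succAboveCases j ?_ (fun i => ?_) i <;> simp

/-- The set lies in a Lipschitz image of a ball of `Fin m → ℝ`, where the m-dimensional Hausdorff
measure is Lebesgue measure. -/
theorem hausdorffMeasure_hyperplane_lt_top {d : ℕ} (j : Fin d) (R : ℝ) :
    Measure.hausdorffMeasure ((d - 1 : ℕ) : ℝ) (Metric.ball (0 : Eu d) R ∩ {y | y j = 0}) < ⊤ := by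
  obtain ⟨m, rfl⟩ : ∃ m, d = m + 1 := ⟨d - 1, by have := j.2; omega⟩
  obtain ⟨K, hK⟩ : ∃ K, LipschitzWith K (hyperplaneMap j) :=
    ⟨_, (LinearMap.toContinuousLinearMap (hyperplaneMap j)).lipschitz⟩
  have hsub : Metric.ball (0 : Eu (m + 1)) R ∩ {y | y j = 0} ⊆
      hyperplaneMap j '' Metric.closedBall 0 R := by
    rintro y ⟨hy, hj⟩
    refine ⟨fun i => y (j.succAbove i), ?_, ?_⟩
    · have hR : ‖y‖ < R := by simpa using hy
      rw [mem_closedBall_zero_iff, pi_norm_le_iff_of_nonneg ((norm_nonneg _).trans hR.le)]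
      exact fun i => (PiLp.norm_apply_le y _).trans hR.le
    · ext i
      refine Fin.succAboveCases j ?_ (fun i => ?_) i
      · simpa [hyperplaneMap] using hj.symm
      · simp [hyperplaneMap]
  refine (measure_mono hsub).trans_lt ((hK.hausdorffMeasure_image_le (by positivity) _).trans_lt ?_)
  refine ENNReal.mul_lt_top (by simp) ?_
  have : Measure.hausdorffMeasure ((m + 1 - 1 : ℕ) : ℝ) = (volume : Measure (Fin m → ℝ)) := by
    rw [← hausdorffMeasure_pi_real]; simp
  rw [this]
  exact (isCompact_closedBall _ _).measure_lt_top

/-- By compactness a local bound suffices. Near each point Γ is the image of a bounded piece of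
hyperplane under the inverse chart, which is C¹ and so locally Lipschitz. -/
theorem IsClosedHypersurface.measure_lt_top {d : ℕ} {Γ : Set (Eu d)}
    (hΓ : IsClosedHypersurface Γ) : Measure.euclideanHausdorffMeasure (d - 1) Γ < ⊤ := by
  rw [Measure.euclideanHausdorffMeasure_def, Measure.smul_apply, ENNReal.smul_def]
  refine ENNReal.mul_lt_top (by simp) ?_
  rw [← inter_self Γ]
  refine hΓ.isCompact.induction_on
    (p := fun s => Measure.hausdorffMeasure ((d - 1 : ℕ) : ℝ) (Γ ∩ s) < ⊤) (by simp)
    (fun s t hst ht => (measure_mono (inter_subset_inter_right _ hst)).trans_lt ht)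
    (fun s t hs ht => by
      rw [inter_union_distrib_left]
      exact (measure_union_le _ _).trans_lt (ENNReal.add_lt_top.2 ⟨hs, ht⟩)) ?_
  intro x hx
  obtain ⟨Φ, j, hxs, -, hsymm, hiff⟩ := hΓ.exists_chart x hx
  have hxt : Φ x ∈ Φ.target := Φ.map_source hxs
  obtain ⟨K, t, ht, hK⟩ := ((hsymm.contDiffAt (Φ.open_target.mem_nhds hxt)).of_le
    (m := 1) (by norm_cast)).exists_lipschitzOnWith
  have hV : Φ.source ∩ Φ ⁻¹' (t ∩ Metric.ball 0 (‖Φ x‖ + 1)) ∈ 𝓝 x := by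
    refine inter_mem (Φ.open_source.mem_nhds hxs) (Φ.continuousAt hxs ?_)
    refine inter_mem ht (Metric.isOpen_ball.mem_nhds ?_)
    simp
  refine ⟨_, mem_nhdsWithin_of_mem_nhds hV, ?_⟩
  set W := t ∩ (Metric.ball (0 : Eu d) (‖Φ x‖ + 1) ∩ {y | y j = 0}) with hW
  have hsub : Γ ∩ (Φ.source ∩ Φ ⁻¹' (t ∩ Metric.ball 0 (‖Φ x‖ + 1))) ⊆ Φ.symm '' W := by
    rintro y ⟨hyΓ, hys, hyt, hyb⟩
    exact ⟨Φ y, ⟨hyt, hyb, (hiff y hys).1 hyΓ⟩, Φ.left_inv hys⟩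
  refine (measure_mono hsub).trans_lt
    (((hK.mono inter_subset_left).hausdorffMeasure_image_le (by positivity)).trans_lt ?_)
  refine ENNReal.mul_lt_top (by simp) ?_
  exact (measure_mono inter_subset_right).trans_lt (hausdorffMeasure_hyperplane_lt_top j _)

theorem IsClosedHypersurface.isFiniteMeasure {d : ℕ} {Γ : Set (Eu d)}
    (hΓ : IsClosedHypersurface Γ) : IsFiniteMeasure (surfaceMeasure Γ) :=
  ⟨by simpa [surfaceMeasure] using hΓ.measure_lt_top⟩

theorem IsClosedHypersurface.ae_mem {d : ℕ} {Γ : Set (Eu d)}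
    (hΓ : IsClosedHypersurface Γ) : ∀ᵐ s ∂(surfaceMeasure Γ), s ∈ Γ :=
  ae_restrict_mem hΓ.isCompact.measurableSet

/-! ### One-dimensional estimates -/

/-- If p is the order of the first nonvanishing derivative at x₀, Taylor's formula makes |f| at
least a multiple of |u - x₀|^p, and |f'| |u - x₀| at most one. -/
theorem derivWithin_mul_le_of_finite_order {f : ℝ → ℝ} {a b x₀ : ℝ} (hab : a < b)
    (hx₀ : x₀ ∈ Icc a b) (hf : ContDiffOn ℝ ∞ f (Icc a b)) {N : ℕ} {β : ℝ} (hβ : 0 < β)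
    (hN : ∀ᶠ u in 𝓝[Icc a b] x₀, β * |u - x₀| ^ N ≤ |f u|) :
    ∃ C : ℝ, ∀ᶠ u in 𝓝[Icc a b] x₀, |derivWithin f (Icc a b) u| * |u - x₀| ≤ C * |f u| := by
  set S := Icc a b with hS
  have hconv : Convex ℝ S := convex_Icc a b
  have huniq : UniqueDiffOn ℝ S := uniqueDiffOn_Icc hab
  have taylor_single : ∀ (g : ℝ → ℝ) (p : ℕ), ContDiffOn ℝ ∞ g S →
      (∀ k < p, iteratedDerivWithin k g S x₀ = 0) → ∀ ε > 0, ∀ᶠ u in 𝓝[S] x₀,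
        |g u - ((p.factorial : ℝ)⁻¹ * iteratedDerivWithin p g S x₀) * (u - x₀) ^ p| ≤
          ε * |u - x₀| ^ p := by
    intro g p hg hk ε hε
    have h := taylor_isLittleO (n := p) hconv hx₀ (hg.of_le (by exact_mod_cast le_top))
    filter_upwards [h.bound hε] with u hu
    rw [taylor_within_apply, Finset.sum_range_succ, Finset.sum_eq_zero, zero_add] at hu
    · simpa [Real.norm_eq_abs, abs_pow, mul_comm, mul_left_comm, mul_assoc] using hu
    · intro k hk'
      rw [hk k (Finset.mem_range.1 hk'), smul_zero]
  -- If all derivatives vanished, the order-N Taylor remainder with factor β/2 would contradict the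
  -- lower bound at points u ≠ x₀.
  have hne : ∃ p, iteratedDerivWithin p f S x₀ ≠ 0 := by
    by_contra! h0
    have h := taylor_single f N hf (fun k _ => h0 k) (β / 2) (by positivity)
    have hacc : (𝓝[S \ {x₀}] x₀).NeBot := by
      have := (huniq x₀ hx₀).accPt
      rwa [accPt_principal_iff_nhdsWithin] at this
    have hle : 𝓝[S \ {x₀}] x₀ ≤ 𝓝[S] x₀ := nhdsWithin_mono _ sdiff_subset
    obtain ⟨u, h1, h2, h3⟩ := ((h.filter_mono hle).and
      ((hN.filter_mono hle).and eventually_mem_nhdsWithin)).exists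
    simp only [h0 N, mul_zero, zero_mul, sub_zero] at h1
    have hpos : 0 < |u - x₀| ^ N := pow_pos (abs_pos.2 (sub_ne_zero.2 h3.2)) _
    nlinarith
  classical
  set p := Nat.find hne with hp
  have hpne : iteratedDerivWithin p f S x₀ ≠ 0 := Nat.find_spec hne
  have hpmin : ∀ k < p, iteratedDerivWithin k f S x₀ = 0 := fun k hk => by
    simpa using Nat.find_min hne hk
  set c := (p.factorial : ℝ)⁻¹ * iteratedDerivWithin p f S x₀ with hc
  have hcpos : 0 < |c| := abs_pos.2 (mul_ne_zero (by positivity) hpne)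
  have hlow : ∀ᶠ u in 𝓝[S] x₀, |c| / 2 * |u - x₀| ^ p ≤ |f u| := by
    filter_upwards [taylor_single f p hf hpmin (|c| / 2) (by positivity)] with u hu
    have h1 : |c * (u - x₀) ^ p| = |c| * |u - x₀| ^ p := by rw [abs_mul, abs_pow]
    have h2 := abs_sub_abs_le_abs_sub (c * (u - x₀) ^ p) (f u)
    rw [abs_sub_comm (c * (u - x₀) ^ p)] at h2
    linarith
  have hdf : ContDiffOn ℝ ∞ (derivWithin f S) S :=
    hf.derivWithin huniq (by norm_cast)
  have hup : ∃ M : ℝ, ∀ᶠ u in 𝓝[S] x₀, |derivWithin f S u| * |u - x₀| ≤ M * |u - x₀| ^ p := by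
    rcases Nat.eq_zero_or_pos p with h0 | hpos
    · refine ⟨1, ?_⟩
      have hcont : ContinuousWithinAt (fun u => |derivWithin f S u| * |u - x₀|) S x₀ :=
        ((hdf.continuousOn x₀ hx₀).abs).mul (by fun_prop)
      have := hcont.tendsto.eventually_lt_const (u := 1) (by simp)
      filter_upwards [this] with u hu
      rw [h0]; simpa using hu.le
    · obtain ⟨q, hq⟩ : ∃ q, p = q + 1 := ⟨p - 1, by omega⟩
      have h := taylor_single (derivWithin f S) q hdf (fun k hk => by
        rw [← iteratedDerivWithin_succ']; exact hpmin _ (by omega)) 1 one_pos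
      set c' := (q.factorial : ℝ)⁻¹ * iteratedDerivWithin q (derivWithin f S) S x₀
      refine ⟨|c'| + 1, ?_⟩
      filter_upwards [h] with u hu
      have h1 : |c' * (u - x₀) ^ q| = |c'| * |u - x₀| ^ q := by rw [abs_mul, abs_pow]
      have h2 := abs_sub_abs_le_abs_sub (derivWithin f S u) (c' * (u - x₀) ^ q)
      rw [hq, pow_succ, ← mul_assoc]
      refine mul_le_mul_of_nonneg_right ?_ (abs_nonneg _)
      linarith
  obtain ⟨M, hM⟩ := hup
  refine ⟨|M| * (2 / |c|), ?_⟩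
  filter_upwards [hlow, hM] with u h1 h2
  calc |derivWithin f S u| * |u - x₀| ≤ M * |u - x₀| ^ p := h2
    _ ≤ |M| * |u - x₀| ^ p := by gcongr; exact le_abs_self M
    _ = |M| * (2 / |c|) * (|c| / 2 * |u - x₀| ^ p) := by field_simp
    _ ≤ _ := by gcongr

theorem ContDiffOn.continuousOn_dn {c : Coefficients} (hn : ContDiffOn ℝ ∞ c.n (Icc (-1) 1)) :
    ContinuousOn c.dn (Icc (-1) 1) :=
  (hn.derivWithin (m := ∞) (uniqueDiffOn_Icc (by norm_num)) (by norm_cast)).continuousOn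

/-- This says that 1 - u² is at most a multiple of |n/n'|, the weight needed in Hardy's inequality.
By compactness it is local; it is clear where n ≠ 0, and at a zero of n it is the preceding
estimate. -/
theorem Coefficients.Admissible.dn_bound {c : Coefficients} (hc : c.Admissible) :
    ∃ K : ℝ, 0 ≤ K ∧ ∀ u ∈ Ioo (-1 : ℝ) 1, |c.dn u| * (1 - u ^ 2) ≤ K * |c.n u| := by
  obtain ⟨N, b, hb, hNb⟩ := hc.finite_order
  have hdn := ContDiffOn.continuousOn_dn hc.n_smooth
  have key : ∃ K : ℝ, ∀ u ∈ Icc (-1 : ℝ) 1, |c.dn u| * (1 - u ^ 2) ≤ K * |c.n u| := by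
    have h := isCompact_Icc.induction_on (s := Icc (-1 : ℝ) 1)
      (p := fun s => ∃ K : ℝ, ∀ u ∈ s ∩ Icc (-1 : ℝ) 1, |c.dn u| * (1 - u ^ 2) ≤ K * |c.n u|)
      ⟨0, by simp⟩ (fun s t hst ⟨K, hK⟩ => ⟨K, fun u hu => hK u ⟨hst hu.1, hu.2⟩⟩)
      (fun s t ⟨K, hK⟩ ⟨L, hL⟩ => ⟨max K L, fun u hu => by
        rcases hu.1 with h | h
        · exact (hK u ⟨h, hu.2⟩).trans (by gcongr; exact le_max_left _ _)
        · exact (hL u ⟨h, hu.2⟩).trans (by gcongr; exact le_max_right _ _)⟩) ?_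
    · obtain ⟨K, hK⟩ := h
      exact ⟨K, fun u hu => hK u ⟨hu, hu⟩⟩
    intro x hx
    have conclude : (∃ K : ℝ, ∀ᶠ u in 𝓝[Icc (-1) 1] x, |c.dn u| * (1 - u ^ 2) ≤ K * |c.n u|) →
        ∃ t ∈ 𝓝[Icc (-1) 1] x, ∃ K : ℝ, ∀ u ∈ t ∩ Icc (-1 : ℝ) 1,
          |c.dn u| * (1 - u ^ 2) ≤ K * |c.n u| := fun ⟨K, hK⟩ => ⟨_, hK, K, fun u hu => hu.1⟩
    apply conclude
    by_cases hnx : c.n x = 0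
    · have hfac : 1 - x ^ 2 = 0 := by
        by_contra hne
        have hpos : 0 < 1 - x ^ 2 :=
          lt_of_le_of_ne (by nlinarith [hx.1, hx.2]) (Ne.symm hne)
        have := hNb x hx
        rw [hnx, abs_zero] at this
        have h2 : 0 < b * (1 - x ^ 2) ^ N := by positivity
        linarith
      have hnear : ∀ᶠ u in 𝓝[Icc (-1) 1] x, u ∈ Icc (-1 : ℝ) 1 ∧ |u - x| < 1 :=
        (eventually_mem_nhdsWithin).and (mem_nhdsWithin_of_mem_nhds
          (by simpa [Metric.ball, Real.dist_eq] using Metric.ball_mem_nhds x one_pos))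
      have hcomp : ∀ᶠ u in 𝓝[Icc (-1) 1] x, |u - x| ≤ 1 - u ^ 2 ∧ 1 - u ^ 2 ≤ 2 * |u - x| := by
        filter_upwards [hnear] with u ⟨hu, hux⟩
        have h4 : (1 - x) * (1 + x) = 0 := by linarith
        rcases mul_eq_zero.1 h4 with h | h
        · have hx1 : x = 1 := by linarith
          subst hx1
          rw [abs_of_nonpos (by linarith [hu.2])] at hux ⊢
          constructor <;> nlinarith [hu.1, hu.2]
        · have hx1 : x = -1 := by linarith
          subst hx1
          rw [abs_of_nonneg (by linarith [hu.1])] at hux ⊢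
          constructor <;> nlinarith [hu.1, hu.2]
      obtain ⟨C, hC⟩ := derivWithin_mul_le_of_finite_order (by norm_num) hx hc.n_smooth
        (N := N) hb (by
          filter_upwards [hcomp, eventually_mem_nhdsWithin] with u h1 hu
          exact le_trans (by gcongr; exact h1.1) (hNb u hu))
      refine ⟨2 * C, ?_⟩
      filter_upwards [hC, hcomp] with u h1 h2
      calc |c.dn u| * (1 - u ^ 2) ≤ |c.dn u| * (2 * |u - x|) := by gcongr; exact h2.2
        _ = 2 * (|c.dn u| * |u - x|) := by ring
        _ ≤ 2 * (C * |c.n u|) := mul_le_mul_of_nonneg_left h1 zero_le_two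
        _ = _ := by ring
    · have h1 : ∀ᶠ u in 𝓝[Icc (-1) 1] x, |c.n x| / 2 < |c.n u| :=
        ((hc.n_smooth.continuousOn x hx).abs).tendsto.eventually_const_lt
          (by have := abs_pos.2 hnx; linarith)
      have h2 : ∀ᶠ u in 𝓝[Icc (-1) 1] x, |c.dn u| < |c.dn x| + 1 :=
        ((hdn x hx).abs).tendsto.eventually_lt_const (by linarith)
      refine ⟨(|c.dn x| + 1) * (2 / |c.n x|), ?_⟩
      filter_upwards [h1, h2] with u h1 h2
      have h0 := abs_pos.2 hnx
      calc |c.dn u| * (1 - u ^ 2) ≤ |c.dn u| * 1 := by gcongr; nlinarith [sq_nonneg u]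
        _ ≤ (|c.dn x| + 1) := by linarith
        _ = (|c.dn x| + 1) * (2 / |c.n x|) * (|c.n x| / 2) := by field_simp
        _ ≤ _ := by gcongr
  obtain ⟨K, hK⟩ := key
  exact ⟨|K|, abs_nonneg _, fun u hu => (hK u (Ioo_subset_Icc_self hu)).trans
    (by gcongr; exact le_abs_self K)⟩

/-- The function 2(1-u)(φ - φ 0)² vanishes at both ends, so its derivative integrates to zero.
Completing the square, together with 1 - u ≤ 1 - u² on [0,1], gives the constant 4. -/
theorem hardy_half {φ : ℝ → ℝ} (hφ : ContDiff ℝ 1 φ) :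
    ∫ u in (0 : ℝ)..1, (φ u - φ 0) ^ 2 ≤
      4 * ∫ u in (0 : ℝ)..1, (1 - u ^ 2) ^ 2 * deriv φ u ^ 2 := by
  have hd : Continuous (deriv φ) := hφ.continuous_deriv le_rfl
  have hc : Continuous φ := hφ.continuous
  have hB : ∀ u, HasDerivAt (fun u => 2 * (1 - u) * (φ u - φ 0) ^ 2)
      (-2 * (φ u - φ 0) ^ 2 + 4 * (1 - u) * (φ u - φ 0) * deriv φ u) u := by
    intro u
    have h1 : HasDerivAt φ (deriv φ u) u := (hφ.differentiable (by norm_num) u).hasDerivAt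
    refine ((((hasDerivAt_id u).const_sub 1).const_mul 2).mul
      ((h1.sub_const (φ 0)).pow 2)).congr_deriv ?_
    simp only [id, Pi.pow_apply, Nat.cast_ofNat]
    ring
  have hint : ∫ u in (0 : ℝ)..1,
      (-2 * (φ u - φ 0) ^ 2 + 4 * (1 - u) * (φ u - φ 0) * deriv φ u) = 0 := by
    rw [intervalIntegral.integral_eq_sub_of_hasDerivAt (fun u _ => hB u)
      (Continuous.intervalIntegrable (by fun_prop) _ _)]
    simp
  have hadd := intervalIntegral.integral_add (μ := volume) (a := 0) (b := 1)
    (f := fun u => (φ u - φ 0) ^ 2)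
    (g := fun u => -2 * (φ u - φ 0) ^ 2 + 4 * (1 - u) * (φ u - φ 0) * deriv φ u)
    (Continuous.intervalIntegrable (by fun_prop) _ _)
    (Continuous.intervalIntegrable (by fun_prop) _ _)
  rw [hint, add_zero] at hadd
  rw [← intervalIntegral.integral_const_mul, ← hadd]
  refine intervalIntegral.integral_mono_on (by norm_num)
    (Continuous.intervalIntegrable (by fun_prop) _ _)
    (Continuous.intervalIntegrable (by fun_prop) _ _) fun u hu => ?_
  have h1 : ((1 - u) * deriv φ u) ^ 2 ≤ (1 - u ^ 2) ^ 2 * deriv φ u ^ 2 := by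
    rw [mul_pow]
    refine mul_le_mul_of_nonneg_right (pow_le_pow_left₀ (by linarith [hu.2]) ?_ 2) (sq_nonneg _)
    nlinarith [hu.1, hu.2]
  nlinarith [sq_nonneg ((φ u - φ 0) - 2 * ((1 - u) * deriv φ u))]

theorem hardy {φ : ℝ → ℝ} (hφ : ContDiff ℝ 1 φ) :
    ∫ u in (-1 : ℝ)..1, (φ u - φ 0) ^ 2 ≤
      4 * ∫ u in (-1 : ℝ)..1, (1 - u ^ 2) ^ 2 * deriv φ u ^ 2 := by
  have hd : Continuous (deriv φ) := hφ.continuous_deriv le_rfl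
  have hc : Continuous φ := hφ.continuous
  have h1 := hardy_half hφ
  have h2 := hardy_half (φ := fun u => φ (-u)) (hφ.comp contDiff_neg)
  simp only [deriv_comp_neg, neg_zero] at h2
  have e1 := intervalIntegral.integral_comp_neg (a := 0) (b := 1) fun u => (φ u - φ 0) ^ 2
  have e2 := intervalIntegral.integral_comp_neg (a := 0) (b := 1)
    fun u => (1 - u ^ 2) ^ 2 * deriv φ u ^ 2
  simp only [neg_zero, neg_sq] at e1 e2 h2
  rw [e1, e2] at h2
  rw [← intervalIntegral.integral_add_adjacent_intervals (a := -1) (b := 0) (c := 1)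
    (Continuous.intervalIntegrable (by fun_prop) _ _)
    (Continuous.intervalIntegrable (by fun_prop) _ _),
    ← intervalIntegral.integral_add_adjacent_intervals (a := -1) (b := 0) (c := 1)
    (Continuous.intervalIntegrable (by fun_prop) _ _)
    (Continuous.intervalIntegrable (by fun_prop) _ _)]
  linarith

/-! ### Properties of the coefficients -/

/-- Lebesgue measure on `[-1,1]`. -/
abbrev ivl : Measure ℝ := volume.restrict (Icc (-1) 1)

theorem ae_ivl_mem_Ioo : ∀ᵐ u ∂ivl, u ∈ Ioo (-1 : ℝ) 1 := by
  rw [ivl, ← restrict_Ioo_eq_restrict_Icc]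
  exact ae_restrict_mem measurableSet_Ioo

theorem intervalIntegral_eq_ivl (f : ℝ → ℝ) : ∫ u in (-1 : ℝ)..1, f u = ∫ u, f u ∂ivl := by
  rw [intervalIntegral.integral_of_le (by norm_num), integral_Icc_eq_integral_Ioc]

theorem integral_ivl_one : ∫ _, (1 : ℝ) ∂ivl = 2 := by
  rw [← intervalIntegral_eq_ivl]; norm_num

theorem Continuous.memLp_ivl {f : ℝ → ℝ} (hf : Continuous f) (p : ENNReal) : MemLp f p ivl := by
  obtain ⟨C, hC⟩ := isCompact_Icc.exists_bound_of_continuousOn (s := Icc (-1 : ℝ) 1)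
    hf.continuousOn
  refine MemLp.of_bound hf.aestronglyMeasurable C ?_
  filter_upwards [ae_restrict_mem measurableSet_Icc] with u hu using hC u hu

theorem sq_integral_ivl_le {w : ℝ → ℝ} (hw : MemLp w 2 ivl) :
    (∫ u, w u ∂ivl) ^ 2 ≤ 2 * ∫ u, w u ^ 2 ∂ivl := by
  have h1 : Integrable w ivl := hw.integrable (by norm_num)
  have h2 : Integrable (fun u => w u ^ 2) ivl := hw.integrable_sq
  set m := (∫ u, w u ∂ivl) / 2 with hm
  have h0 : 0 ≤ ∫ u, (w u - m) ^ 2 ∂ivl := integral_nonneg fun u => sq_nonneg _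
  have he : ∀ u, (w u - m) ^ 2 = w u ^ 2 - 2 * m * w u + m ^ 2 * 1 := fun u => by ring
  simp_rw [he] at h0
  rw [integral_add (f := fun u => w u ^ 2 - 2 * m * w u) (h2.sub (h1.const_mul _))
    (integrable_const _), integral_sub h2
    (h1.const_mul _), integral_const_mul, integral_const_mul, integral_ivl_one] at h0
  have : ∫ u, w u ∂ivl = 2 * m := by rw [hm]; ring
  rw [this] at h0 ⊢
  nlinarith

namespace Coefficients

variable {c : Coefficients}

theorem sa_nonneg (hc : c.Admissible) {u : ℝ} (hu : u ∈ Ioo (-1 : ℝ) 1) : 0 ≤ c.sa u := by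
  have := hc.A_tau_pos u hu
  unfold sa
  positivity

theorem one_sub_sq_pos {u : ℝ} (hu : u ∈ Ioo (-1 : ℝ) 1) : 0 < 1 - u ^ 2 := by
  nlinarith [hu.1, hu.2]

/-- 𝖺 is (n/n')² times the quotient that the hypothesis bounds below by ι. -/
theorem exists_sq_le_sa (hc : c.Admissible) :
    ∃ L : ℝ, 0 < L ∧ ∀ u ∈ Ioo (-1 : ℝ) 1, (c.n u / c.dn u) ^ 2 ≤ L * c.sa u := by
  obtain ⟨ι, hι, h⟩ := hc.lower_bound
  refine ⟨ι⁻¹, by positivity, fun u hu => ?_⟩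
  have h1 := h u hu
  have h2 := hc.A_tau_pos u hu
  have h3 : 0 < √(1 - u ^ 2) := Real.sqrt_pos.2 (one_sub_sq_pos hu)
  have e : c.sa u = c.n u ^ 2 / (c.A u ^ 2 * c.tau u * √(1 - u ^ 2)) * (c.n u / c.dn u) ^ 2 := by
    unfold sa
    simp only [div_eq_mul_inv, mul_inv, mul_pow, one_mul]
    ring
  rw [e, inv_mul_eq_div, le_div_iff₀ hι, mul_comm]
  exact mul_le_mul_of_nonneg_right h1 (sq_nonneg _)

theorem ae_sa_pos (hc : c.Admissible) : ∀ᵐ u ∂ivl, 0 < c.sa u := by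
  filter_upwards [ae_ivl_mem_Ioo, hc.n_ne_zero] with u hu h
  have h2 := hc.A_tau_pos u hu
  have h3 : 0 < √(1 - u ^ 2) := Real.sqrt_pos.2 (one_sub_sq_pos hu)
  have h4 : 0 < (c.n u ^ 2 / c.dn u) ^ 2 := by
    have := div_ne_zero (pow_ne_zero 2 h.1) h.2
    positivity
  unfold sa
  positivity

theorem sm_pos (hc : c.Admissible) {u : ℝ} (hu : u ∈ Ioo (-1 : ℝ) 1) : 0 < c.sm u := by
  obtain ⟨i, mt, -, hpos, hm⟩ := hc.m_form
  have h1 := one_sub_sq_pos hu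
  unfold sm
  rw [hm u (Ioo_subset_Icc_self hu)]
  exact div_pos (mul_pos (pow_pos h1 _) (hpos u (Ioo_subset_Icc_self hu))) (Real.sqrt_pos.2 h1)

theorem aestronglyMeasurable_ratio (hc : c.Admissible) :
    AEStronglyMeasurable (fun u => c.n u / c.dn u) ivl :=
  (hc.n_smooth.continuousOn.aemeasurable measurableSet_Icc).div
    ((ContDiffOn.continuousOn_dn hc.n_smooth).aemeasurable measurableSet_Icc)
    |>.aestronglyMeasurable

theorem aestronglyMeasurable_sa (hc : c.Admissible) : AEStronglyMeasurable c.sa ivl := by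
  have h1 := hc.n_smooth.continuousOn.aemeasurable (μ := volume) measurableSet_Icc
  have h2 := (ContDiffOn.continuousOn_dn hc.n_smooth).aemeasurable (μ := volume) measurableSet_Icc
  have h3 := hc.A_smooth.continuousOn.aemeasurable (μ := volume) measurableSet_Icc
  have h4 := hc.tau_smooth.continuousOn.aemeasurable (μ := volume) measurableSet_Icc
  have h5 : AEMeasurable (fun u : ℝ => √(1 - u ^ 2)) ivl := by fun_prop
  exact (((((h3.pow_const 2).mul h4).const_div 1).mul (((h1.pow_const 2).div h2).pow_const 2)).mul
    (h5.const_div 1)).aestronglyMeasurable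

theorem integrable_sm (hc : c.Admissible) : Integrable c.sm ivl := by
  obtain ⟨i, mt, hmt, -, hm⟩ := hc.m_form
  have hcont : ContinuousOn (fun u => (1 - u ^ 2) ^ i * mt u) (Icc (-1) 1) :=
    ContinuousOn.mul (by fun_prop) hmt.continuousOn
  obtain ⟨C, hC⟩ := isCompact_Icc.exists_bound_of_continuousOn hcont
  -- The singular factor is the nonnegative derivative of arcsin.
  have h1 : Integrable (fun u : ℝ => 1 / √(1 - u ^ 2)) ivl := by
    have := intervalIntegral.integrableOn_deriv_of_nonneg (a := -1) (b := 1)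
      Real.continuous_arcsin.continuousOn
      (fun x hx => Real.hasDerivAt_arcsin hx.1.ne' hx.2.ne) (fun x hx => by positivity)
    rwa [← integrableOn_Icc_iff_integrableOn_Ioc] at this
  have h2 := h1.bdd_mul (c := C) (hcont.aestronglyMeasurable measurableSet_Icc)
    (by filter_upwards [ae_restrict_mem measurableSet_Icc] with u hu using hC u hu)
  refine h2.congr ?_
  filter_upwards [ae_restrict_mem measurableSet_Icc] with u hu
  simp only [sm, hm u hu, mul_one_div]

theorem memLp_sqrt_sm (hc : c.Admissible) : MemLp (fun u => √(c.sm u)) 2 ivl := by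
  have h := integrable_sm hc
  refine (memLp_two_iff_integrable_sq (f := fun u => √(c.sm u))
    (Real.continuous_sqrt.comp_aestronglyMeasurable h.1)).2 (h.congr ?_)
  filter_upwards [ae_ivl_mem_Ioo] with u hu
  rw [Real.sq_sqrt (sm_pos hc hu).le]

/-- The bounded weight `(n / n') / √𝖺`. -/
def weight (c : Coefficients) (u : ℝ) : ℝ := c.n u / c.dn u / √(c.sa u)

theorem weight_mul_ae (hc : c.Admissible) :
    ∀ᵐ u ∂ivl, c.weight u * √(c.sa u) = c.n u / c.dn u := by
  filter_upwards [ae_sa_pos hc] with u hu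
  exact div_mul_cancel₀ _ (Real.sqrt_pos.2 hu).ne'

/-- Boundedness of this weight makes the term ∫ (n/n') ∂_u f continuous in the energy norm. -/
theorem memLp_weight (hc : c.Admissible) : MemLp c.weight ⊤ ivl := by
  obtain ⟨L, hL, h⟩ := exists_sq_le_sa hc
  have hm : AEStronglyMeasurable c.weight ivl :=
    ((aestronglyMeasurable_ratio hc).aemeasurable.div
      (aestronglyMeasurable_sa hc).aemeasurable.sqrt).aestronglyMeasurable
  refine memLp_top_of_bound hm (√L) ?_
  filter_upwards [ae_ivl_mem_Ioo, ae_sa_pos hc] with u hu h0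
  refine Real.abs_le_sqrt ?_
  rw [weight, div_pow, Real.sq_sqrt h0.le, div_le_iff₀ h0]
  exact h u hu

/-- The constraint for functions of `u` alone. -/
def constraintOne (c : Coefficients) (φ : ℝ → ℝ) : ℝ :=
  ∫ u in (-1 : ℝ)..1, (φ u + c.n u / c.dn u * deriv φ u)

theorem memLp_ratio_mul (hc : c.Admissible) {ψ : ℝ → ℝ}
    (hψ : MemLp (fun u => √(c.sa u) * ψ u) 2 ivl) :
    MemLp (fun u => c.n u / c.dn u * ψ u) 2 ivl := by
  refine (hψ.mul (r := 2) (memLp_weight hc)).ae_eq ?_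
  filter_upwards [weight_mul_ae hc] with u hu
  simp only [Pi.mul_apply]
  rw [← hu]
  ring

/-- Hardy's inequality bounds φ - φ 0 by (1-u²)φ', `dn_bound` replaces the weight by K|n/n'|, and
`exists_sq_le_sa` passes to √𝖺. The remaining constant φ 0 is recovered from the constraint. -/
theorem poincare (hc : c.Admissible) : ∃ K : ℝ, 0 ≤ K ∧ ∀ φ : ℝ → ℝ, ContDiff ℝ 1 φ →
    MemLp (fun u => √(c.sa u) * deriv φ u) 2 ivl →
    ∫ u, φ u ^ 2 ∂ivl ≤ K * (∫ u, (√(c.sa u) * deriv φ u) ^ 2 ∂ivl + c.constraintOne φ ^ 2) := by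
  obtain ⟨L, hL, hLsa⟩ := exists_sq_le_sa hc
  obtain ⟨K, hK, hKn⟩ := hc.dn_bound
  -- With w = (n/n')φ' and P = ∫ (φ - φ 0)², the proof reaches ∫ φ² ≤ 8P + 6∫ w² + 3(𝒞φ)², where P ≤
  -- 4K²∫ w² and ∫ w² ≤ L D.
  refine ⟨32 * K ^ 2 * L + 6 * L + 3, by positivity, fun φ hφ hmem => ?_⟩
  set w : ℝ → ℝ := fun u => c.n u / c.dn u * deriv φ u with hw
  have hwL2 : MemLp w 2 ivl := memLp_ratio_mul hc hmem
  have hdc : Continuous (deriv φ) := hφ.continuous_deriv le_rfl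
  have hcc : Continuous φ := hφ.continuous
  set D := ∫ u, (√(c.sa u) * deriv φ u) ^ 2 ∂ivl with hD
  have hwD : ∫ u, w u ^ 2 ∂ivl ≤ L * D := by
    rw [hD, ← integral_const_mul]
    refine integral_mono_ae hwL2.integrable_sq (hmem.integrable_sq.const_mul L) ?_
    filter_upwards [ae_ivl_mem_Ioo] with u hu
    simp only [hw, mul_pow, Real.sq_sqrt (sa_nonneg hc hu)]
    rw [← mul_assoc]
    exact mul_le_mul_of_nonneg_right (hLsa u hu) (sq_nonneg _)
  set P := ∫ u, (φ u - φ 0) ^ 2 ∂ivl with hP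
  have hPw : P ≤ 4 * (K ^ 2 * ∫ u, w u ^ 2 ∂ivl) := by
    have h := hardy hφ
    rw [intervalIntegral_eq_ivl, intervalIntegral_eq_ivl] at h
    refine h.trans (mul_le_mul_of_nonneg_left ?_ (by norm_num))
    rw [← integral_const_mul]
    refine integral_mono_ae ((Continuous.memLp_ivl (by fun_prop) 1).integrable le_rfl)
      (hwL2.integrable_sq.const_mul _) ?_
    filter_upwards [ae_ivl_mem_Ioo, hc.n_ne_zero] with u hu hne
    have h1 := hKn u hu
    have h2 : (1 - u ^ 2) ≤ K * |c.n u / c.dn u| := by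
      rw [abs_div, ← mul_div_assoc, le_div_iff₀ (abs_pos.2 hne.2), mul_comm]
      exact h1
    simp only [hw]
    rw [mul_pow (c.n u / c.dn u), ← mul_assoc, ← sq_abs (c.n u / c.dn u), ← mul_pow K]
    exact mul_le_mul_of_nonneg_right (pow_le_pow_left₀ (one_sub_sq_pos hu).le h2 2) (sq_nonneg _)
  have hφ1 : Integrable φ ivl := (Continuous.memLp_ivl hcc 1).integrable le_rfl
  have hψ : MemLp (fun u => φ u - φ 0) 2 ivl := Continuous.memLp_ivl (by fun_prop) 2
  have hw1 : Integrable w ivl := hwL2.integrable (by norm_num)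
  have hc1 : c.constraintOne φ = (∫ u, φ u ∂ivl) + ∫ u, w u ∂ivl := by
    rw [constraintOne, intervalIntegral_eq_ivl, ← integral_add hφ1 hw1]
  have hψint : ∫ u, (φ u - φ 0) ∂ivl = (∫ u, φ u ∂ivl) - 2 * φ 0 := by
    rw [integral_sub hφ1 (integrable_const _)]
    have : ∫ _, φ 0 ∂ivl = φ 0 * ∫ _, (1 : ℝ) ∂ivl := by rw [← integral_const_mul]; simp
    rw [this, integral_ivl_one]; ring
  have hs1 := sq_integral_ivl_le hwL2
  have hs2 := sq_integral_ivl_le hψ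
  rw [hψint] at hs2
  have hsum : ∫ u, φ u ^ 2 ∂ivl ≤ 2 * P + 4 * φ 0 ^ 2 := by
    have : ∫ u, φ u ^ 2 ∂ivl ≤ ∫ u, (2 * (φ u - φ 0) ^ 2 + 2 * φ 0 ^ 2 * 1) ∂ivl :=
      integral_mono ((Continuous.memLp_ivl (by fun_prop) 1).integrable le_rfl)
        ((hψ.integrable_sq.const_mul 2).add (integrable_const _))
        fun u => by nlinarith [sq_nonneg (φ u - φ 0 - φ 0)]
    rw [integral_add (hψ.integrable_sq.const_mul 2) (integrable_const _), integral_const_mul,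
      integral_const_mul, integral_ivl_one] at this
    linarith
  -- The identity behind this is 2φ(0) = 𝒞φ - ∫ w - (∫ φ - 2φ(0)).
  have hsq : 4 * φ 0 ^ 2 ≤ 3 * c.constraintOne φ ^ 2 + 3 * (∫ u, w u ∂ivl) ^ 2 +
      3 * ((∫ u, φ u ∂ivl) - 2 * φ 0) ^ 2 := by
    rw [hc1]
    set a := ∫ u, φ u ∂ivl
    set b := ∫ u, w u ∂ivl
    nlinarith [sq_nonneg ((a + b) + b), sq_nonneg (b - (a - 2 * φ 0)),
      sq_nonneg ((a + b) + (a - 2 * φ 0))]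
  have hfin : ∫ u, φ u ^ 2 ∂ivl ≤ 8 * P + 6 * (∫ u, w u ^ 2 ∂ivl) + 3 * c.constraintOne φ ^ 2 := by
    linarith
  have hK2 : K ^ 2 * ∫ u, w u ^ 2 ∂ivl ≤ K ^ 2 * (L * D) :=
    mul_le_mul_of_nonneg_left hwD (sq_nonneg K)
  have hD0 : 0 ≤ D := integral_nonneg fun u => sq_nonneg _
  have h1 : 0 ≤ (32 * K ^ 2 * L + 6 * L) * c.constraintOne φ ^ 2 := by positivity
  nlinarith

end Coefficients

/-! ### Tensor products on the cylinder -/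

section Cyl

variable {d : ℕ} {Γ : Set (Eu d)} {E : Type*} [NormedAddCommGroup E] [InnerProductSpace ℝ E]

instance [IsFiniteMeasure (surfaceMeasure Γ)] : IsFiniteMeasure (cylMeasure Γ) :=
  inferInstanceAs (IsFiniteMeasure ((surfaceMeasure Γ).prod ivl))

theorem ae_cyl_of_ae_ivl {p : ℝ → Prop} (h : ∀ᵐ y ∂ivl, p y) : ∀ᵐ z ∂(cylMeasure Γ), p z.2 :=
  ae_prod_of_ae_right h

theorem ae_cyl_of_ae_surface {p : Eu d → Prop} (h : ∀ᵐ y ∂(surfaceMeasure Γ), p y) :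
    ∀ᵐ z ∂(cylMeasure Γ), p z.1 :=
  ae_prod_of_ae_left h

theorem ae_surface_ae_ivl {p : Eu d × ℝ → Prop} (h : ∀ᵐ z ∂(cylMeasure Γ), p z) :
    ∀ᵐ s ∂(surfaceMeasure Γ), ∀ᵐ u ∂ivl, p (s, u) :=
  Measure.ae_ae_of_ae_prod h

variable [IsFiniteMeasure (surfaceMeasure Γ)]

variable (Γ E) in
/-- The bilinear map `(b, p) ↦ b ⊗ p` with values in functions on the cylinder. -/
def cylTens : Lp E 2 (surfaceMeasure Γ) →L[ℝ] Lp ℝ 2 ivl →L[ℝ] Lp E 2 (cylMeasure Γ) :=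
  tens (surfaceMeasure Γ) ivl E

theorem cylTens_coe (b : Lp E 2 (surfaceMeasure Γ)) (p : Lp ℝ 2 ivl) :
    cylTens Γ E b p =ᵐ[cylMeasure Γ] fun z => p z.2 • b z.1 :=
  tens_coe b p

theorem ae_ivl_ae_surface {p : Eu d × ℝ → Prop} (h : ∀ᵐ z ∂(cylMeasure Γ), p z) :
    ∀ᵐ u ∂ivl, ∀ᵐ s ∂(surfaceMeasure Γ), p (s, u) :=
  ae_ae_of_ae_prod_swap h

variable [CompleteSpace E]

/-- The partial inner product `G ↦ ∫ ⟪b s, G (s, ·)⟫`. -/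
def cylPart (b : Lp E 2 (surfaceMeasure Γ)) : Lp E 2 (cylMeasure Γ) →L[ℝ] Lp ℝ 2 ivl :=
  partialInner b

theorem inner_cylPart (b : Lp E 2 (surfaceMeasure Γ)) (G : Lp E 2 (cylMeasure Γ))
    (p : Lp ℝ 2 ivl) : ⟪cylPart b G, p⟫_ℝ = ⟪G, cylTens Γ E b p⟫_ℝ :=
  inner_partialInner b G p

theorem cylPart_inner (b : Lp E 2 (surfaceMeasure Γ)) (G : Lp E 2 (cylMeasure Γ))
    (p : Lp ℝ 2 ivl) : ⟪p, cylPart b G⟫_ℝ = ⟪cylTens Γ E b p, G⟫_ℝ :=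
  partialInner_inner b G p

theorem cylPart_cylTens (b b' : Lp E 2 (surfaceMeasure Γ)) (p : Lp ℝ 2 ivl) :
    cylPart b (cylTens Γ E b' p) = ⟪b, b'⟫_ℝ • p :=
  partialInner_tens b b' p

theorem cylPart_coe (b : Lp E 2 (surfaceMeasure Γ)) (G : Lp E 2 (cylMeasure Γ)) :
    cylPart b G =ᵐ[ivl] fun u => ∫ s, ⟪b s, G (s, u)⟫_ℝ ∂(surfaceMeasure Γ) :=
  partialInner_coe b G

end Cyl

theorem Lp.norm_sq_eq_integral {α : Type*} [MeasurableSpace α] {m : Measure α} (F : Lp ℝ 2 m) :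
    ‖F‖ ^ 2 = ∫ z, F z ^ 2 ∂m := by
  rw [← real_inner_self_eq_norm_sq, L2.inner_def]
  simp [sq]

/-! ### Smooth functions on the cylinder -/

section Smooth

variable {d : ℕ} {Γ : Set (Eu d)} {c : Coefficients}

theorem norm_h1val_le (h : H1 Γ) : ‖h1val h‖ ≤ ‖h‖ :=
  WithLp.norm_fst_le _ (h : WithLp 2 (L2 Γ × L2Vec Γ))

theorem vertical_deriv_eq {f : Eu d × ℝ → ℝ} (hf : ContDiff ℝ ∞ f) (p : Eu d × ℝ) :
    HasDerivAt (fun v => f (p.1, v)) (fderiv ℝ f p (0, 1)) p.2 := by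
  have h1 : HasFDerivAt f (fderiv ℝ f p) (p.1, p.2) :=
    (hf.differentiable (by simp) p).hasFDerivAt
  exact h1.comp_hasDerivAt p.2 ((hasDerivAt_const p.2 p.1).prodMk (hasDerivAt_id p.2))

theorem contDiff_vertical_deriv {f : Eu d × ℝ → ℝ} (hf : ContDiff ℝ ∞ f) :
    ContDiff ℝ ∞ fun p : Eu d × ℝ => deriv (fun v => f (p.1, v)) p.2 := by
  have h : (fun p : Eu d × ℝ => deriv (fun v => f (p.1, v)) p.2) =
      fun p => fderiv ℝ f p (0, 1) := funext fun p => (vertical_deriv_eq hf p).deriv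
  rw [h]
  exact (hf.fderiv_right (m := ∞) (by norm_cast)).clm_apply contDiff_const

theorem contDiff_section {f : Eu d × ℝ → ℝ} (hf : ContDiff ℝ ∞ f) (s : Eu d) :
    ContDiff ℝ ∞ fun u => f (s, u) :=
  hf.comp (contDiff_const.prodMk contDiff_id)

theorem contDiff_slice {f : Eu d × ℝ → ℝ} (hf : ContDiff ℝ ∞ f) (u : ℝ) :
    ContDiff ℝ ∞ fun s => f (s, u) :=
  hf.comp (contDiff_id.prodMk contDiff_const)

theorem surfaceGradient_add {f g : Eu d → ℝ} {x : Eu d} (hf : DifferentiableAt ℝ f x)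
    (hg : DifferentiableAt ℝ g x) :
    surfaceGradient Γ (fun y => f y + g y) x = surfaceGradient Γ f x + surfaceGradient Γ g x := by
  rw [surfaceGradient, surfaceGradient, surfaceGradient, ← map_add]
  congr 1
  simp only [gradient]
  rw [fderiv_fun_add hf hg, map_add]

theorem surfaceGradient_const_mul {f : Eu d → ℝ} {x : Eu d} (r : ℝ)
    (hf : DifferentiableAt ℝ f x) :
    surfaceGradient Γ (fun y => r * f y) x = r • surfaceGradient Γ f x := by
  rw [surfaceGradient, surfaceGradient, ← map_smul]
  congr 1
  simp only [gradient]
  rw [fderiv_const_mul hf]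
  simp

theorem Continuous.memLp_cyl [IsFiniteMeasure (surfaceMeasure Γ)] (hΓ : IsClosedHypersurface Γ)
    {f : Eu d × ℝ → ℝ} (hf : Continuous f) : MemLp f 2 (cylMeasure Γ) := by
  obtain ⟨C, hC⟩ := (hΓ.isCompact.prod (isCompact_Icc (a := (-1 : ℝ)) (b := 1))
    ).exists_bound_of_continuousOn hf.continuousOn
  refine MemLp.of_bound hf.aestronglyMeasurable C ?_
  filter_upwards [ae_cyl_of_ae_surface hΓ.ae_mem,
    ae_cyl_of_ae_ivl (ae_restrict_mem measurableSet_Icc)] with z h1 h2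
  exact hC z ⟨h1, h2⟩

theorem Continuous.memLp_surface [IsFiniteMeasure (surfaceMeasure Γ)]
    (hΓ : IsClosedHypersurface Γ) {f : Eu d → ℝ} (hf : Continuous f) :
    MemLp f 2 (surfaceMeasure Γ) := by
  obtain ⟨C, hC⟩ := hΓ.isCompact.exists_bound_of_continuousOn hf.continuousOn
  refine MemLp.of_bound hf.aestronglyMeasurable C ?_
  filter_upwards [hΓ.ae_mem] with z h1
  exact hC z h1

theorem IsSmoothElement.smul (r : ℝ) {f : Eu d × ℝ → ℝ} {x : Ambient Γ}
    (hf : IsSmoothElement Γ c f x) : IsSmoothElement Γ c (fun p => r * f p) (r • x) := by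
  have hd : ∀ s u, deriv (fun v => r * f (s, v)) u = r * deriv (fun v => f (s, v)) u :=
    fun s u => deriv_const_mul_field _
  refine ⟨contDiff_const.mul hf.1, ?_, ?_, ?_⟩
  · filter_upwards [Lp.coeFn_smul r x.fst, hf.2.1] with p h1 h2
    rw [WithLp.smul_fst, h1, Pi.smul_apply, h2, hd, smul_eq_mul]
    ring
  · filter_upwards [Lp.coeFn_smul r x.snd.fst, hf.2.2.1] with p h1 h2
    rw [WithLp.smul_snd, WithLp.smul_fst, h1, Pi.smul_apply, h2, surfaceGradient_const_mul r
      ((contDiff_slice hf.1 p.2).differentiable (by simp) _), smul_comm]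
  · have e : h1val (r • x).snd.snd = r • h1val x.snd.snd := rfl
    rw [e]
    filter_upwards [Lp.coeFn_smul r (h1val x.snd.snd), hf.2.2.2] with s h1 h2
    rw [h1, Pi.smul_apply, h2, constraintFun, constraintFun, smul_eq_mul,
      ← intervalIntegral.integral_const_mul]
    refine intervalIntegral.integral_congr fun u _ => ?_
    simp only [hd]
    ring

variable [IsFiniteMeasure (surfaceMeasure Γ)]

/-- 𝖺 need not be integrable, so smoothness of f is not enough; Fubini gives the claim for almost
every s only. -/
theorem IsSmoothElement.memLp_section (hc : c.Admissible) {f : Eu d × ℝ → ℝ} {x : Ambient Γ}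
    (h : IsSmoothElement Γ c f x) : ∀ᵐ s ∂(surfaceMeasure Γ),
      MemLp (fun u => √(c.sa u) * deriv (fun v => f (s, v)) u) 2 ivl := by
  have h1 : Integrable (fun z => x.fst z ^ 2) ((surfaceMeasure Γ).prod ivl) :=
    (Lp.memLp x.fst).integrable_sq
  filter_upwards [h1.prod_right_ae, ae_surface_ae_ivl h.2.1] with s hs1 hs2
  have hd : Continuous fun u => deriv (fun v => f (s, v)) u :=
    (contDiff_section h.1 s).continuous_deriv (by simp)
  have hm : AEStronglyMeasurable (fun u => √(c.sa u) * deriv (fun v => f (s, v)) u) ivl :=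
    (Real.continuous_sqrt.comp_aestronglyMeasurable
      (Coefficients.aestronglyMeasurable_sa hc)).mul hd.aestronglyMeasurable
  refine (memLp_two_iff_integrable_sq hm).2 (hs1.congr ?_)
  filter_upwards [hs2] with u hu
  rw [hu]

theorem IsSmoothElement.intervalIntegrable_constraint (hc : c.Admissible) {f : Eu d × ℝ → ℝ}
    {x : Ambient Γ} (h : IsSmoothElement Γ c f x) : ∀ᵐ s ∂(surfaceMeasure Γ),
      IntervalIntegrable (fun u => f (s, u) + c.n u / c.dn u * deriv (fun v => f (s, v)) u)
        volume (-1) 1 := by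
  filter_upwards [h.memLp_section hc] with s hs
  rw [intervalIntegrable_iff_integrableOn_Icc_of_le (by norm_num)]
  exact ((Continuous.memLp_ivl (contDiff_section h.1 s).continuous 1).integrable le_rfl).add
    ((Coefficients.memLp_ratio_mul hc hs).integrable (by norm_num))

/-- The integral in the constraint is additive only where both integrands are integrable, which
holds for almost every s. -/
theorem IsSmoothElement.add (hc : c.Admissible) {f g : Eu d × ℝ → ℝ} {x y : Ambient Γ}
    (hf : IsSmoothElement Γ c f x) (hg : IsSmoothElement Γ c g y) :
    IsSmoothElement Γ c (fun p => f p + g p) (x + y) := by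
  have hd : ∀ s u, deriv (fun v => f (s, v) + g (s, v)) u =
      deriv (fun v => f (s, v)) u + deriv (fun v => g (s, v)) u := fun s u =>
    deriv_fun_add ((contDiff_section hf.1 s).differentiable (by simp) u)
      ((contDiff_section hg.1 s).differentiable (by simp) u)
  refine ⟨hf.1.add hg.1, ?_, ?_, ?_⟩
  · filter_upwards [Lp.coeFn_add x.fst y.fst, hf.2.1, hg.2.1] with p h1 h2 h3
    rw [WithLp.add_fst, h1, Pi.add_apply, h2, h3, hd]
    ring
  · filter_upwards [Lp.coeFn_add x.snd.fst y.snd.fst, hf.2.2.1, hg.2.2.1] with p h1 h2 h3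
    rw [WithLp.add_snd, WithLp.add_fst, h1, Pi.add_apply, h2, h3, surfaceGradient_add
      ((contDiff_slice hf.1 p.2).differentiable (by simp) _)
      ((contDiff_slice hg.1 p.2).differentiable (by simp) _), smul_add]
  · have e : h1val (x + y).snd.snd = h1val x.snd.snd + h1val y.snd.snd := rfl
    rw [e]
    filter_upwards [Lp.coeFn_add (h1val x.snd.snd) (h1val y.snd.snd), hf.2.2.2, hg.2.2.2,
      hf.intervalIntegrable_constraint hc, hg.intervalIntegrable_constraint hc]
      with s h1 h2 h3 h4 h5
    rw [h1, Pi.add_apply, h2, h3, constraintFun, constraintFun, constraintFun,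
      ← intervalIntegral.integral_add h4 h5]
    refine intervalIntegral.integral_congr fun u _ => ?_
    simp only [hd]
    ring

variable (Γ) in
/-- The graph of `f ↦ f` between the energy norm and `L²`, for smooth `f`. -/
def smoothGraph (hc : c.Admissible) : Submodule ℝ (Ambient Γ × CylL2 Γ) where
  carrier := {z | ∃ φ, IsSmoothElement Γ c φ z.1 ∧ z.2 =ᵐ[cylMeasure Γ] φ}
  add_mem' := by
    rintro z w ⟨f, hf, hf'⟩ ⟨g, hg, hg'⟩
    refine ⟨_, hf.add hc hg, ?_⟩
    filter_upwards [Lp.coeFn_add z.2 w.2, hf', hg'] with p h1 h2 h3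
    rw [Prod.snd_add, h1, Pi.add_apply, h2, h3]
  zero_mem' := by
    refine ⟨fun _ => 0, ⟨contDiff_const, ?_, ?_, ?_⟩, Lp.coeFn_zero _ _ _⟩
    · filter_upwards [Lp.coeFn_zero ℝ 2 (cylMeasure Γ)] with p hp
      simpa using hp
    · filter_upwards [Lp.coeFn_zero (Eu d) 2 (cylMeasure Γ)] with p hp
      simpa [surfaceGradient, gradient_fun_const] using hp
    · filter_upwards [Lp.coeFn_zero ℝ 2 (surfaceMeasure Γ)] with p hp
      have e : h1val (Γ := Γ) 0 = 0 := rfl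
      simp only [constraintFun, Prod.fst_zero, WithLp.zero_snd, e, hp]
      simp
  smul_mem' := by
    rintro r z ⟨f, hf, hf'⟩
    refine ⟨_, hf.smul r, ?_⟩
    filter_upwards [Lp.coeFn_smul r z.2, hf'] with p h1 h2
    rw [Prod.smul_snd, h1, Pi.smul_apply, h2, smul_eq_mul]

theorem IsSmoothElement.exists_mem_graph (hΓ : IsClosedHypersurface Γ) (hc : c.Admissible)
    {f : Eu d × ℝ → ℝ} {x : Ambient Γ} (hf : IsSmoothElement Γ c f x) :
    ∃ g, (x, g) ∈ smoothGraph Γ hc :=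
  ⟨(Continuous.memLp_cyl hΓ hf.1.continuous).toLp f, f, hf,
    MemLp.coeFn_toLp (Continuous.memLp_cyl hΓ hf.1.continuous)⟩

/-- The one-dimensional Poincaré inequality, applied on almost every fibre {s} × [-1,1] and
integrated over Γ. -/
theorem smoothGraph_bound (hc : c.Admissible) :
    ∃ K : ℝ, 0 ≤ K ∧ ∀ z ∈ smoothGraph Γ hc, ‖z.2‖ ≤ K * ‖z.1‖ := by
  obtain ⟨K, hK, hP⟩ := Coefficients.poincare hc
  refine ⟨√K, Real.sqrt_nonneg _, ?_⟩
  rintro ⟨x, g⟩ ⟨f, hf, hfg⟩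
  have hg2 : Integrable (fun z => g z ^ 2) ((surfaceMeasure Γ).prod ivl) :=
    (Lp.memLp g).integrable_sq
  have hx2 : Integrable (fun z => x.fst z ^ 2) ((surfaceMeasure Γ).prod ivl) :=
    (Lp.memLp x.fst).integrable_sq
  have hC2 : Integrable (fun s => h1val x.snd.snd s ^ 2) (surfaceMeasure Γ) :=
    (Lp.memLp (h1val x.snd.snd)).integrable_sq
  have e1 : ‖g‖ ^ 2 = ∫ s, ∫ u, g (s, u) ^ 2 ∂ivl ∂(surfaceMeasure Γ) := by
    rw [Lp.norm_sq_eq_integral]; exact integral_prod _ hg2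
  have e2 : ‖x.fst‖ ^ 2 = ∫ s, ∫ u, x.fst (s, u) ^ 2 ∂ivl ∂(surfaceMeasure Γ) := by
    rw [Lp.norm_sq_eq_integral]; exact integral_prod _ hx2
  have e3 := Lp.norm_sq_eq_integral (h1val x.snd.snd)
  have key : ‖g‖ ^ 2 ≤ K * (‖x.fst‖ ^ 2 + ‖h1val x.snd.snd‖ ^ 2) := by
    rw [e1, e2, e3, ← integral_add hx2.integral_prod_left hC2, ← integral_const_mul]
    refine integral_mono_ae hg2.integral_prod_left
      ((hx2.integral_prod_left.add hC2).const_mul K) ?_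
    filter_upwards [ae_surface_ae_ivl hfg, ae_surface_ae_ivl hf.2.1, hf.2.2.2,
      hf.memLp_section hc] with s h1 h2 h3 h4
    have h5 := hP (fun u => f (s, u)) ((contDiff_section hf.1 s).of_le (by norm_cast)) h4
    have i1 : ∫ u, g (s, u) ^ 2 ∂ivl = ∫ u, f (s, u) ^ 2 ∂ivl :=
      integral_congr_ae (h1.mono fun u hu => by simp only [hu])
    have i2 : ∫ u, x.fst (s, u) ^ 2 ∂ivl =
        ∫ u, (√(c.sa u) * deriv (fun v => f (s, v)) u) ^ 2 ∂ivl :=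
      integral_congr_ae (h2.mono fun u hu => by simp only [hu])
    simp only [i1, i2, h3]
    exact h5
  have n1 := WithLp.prod_norm_sq_eq_of_L2 x
  have n2 := WithLp.prod_norm_sq_eq_of_L2 x.snd
  have n3 := norm_h1val_le x.snd.snd
  have n4 : ‖h1val x.snd.snd‖ ^ 2 ≤ ‖x.snd.snd‖ ^ 2 := pow_le_pow_left₀ (norm_nonneg _) n3 2
  have hle : ‖g‖ ^ 2 ≤ (√K * ‖x‖) ^ 2 := by
    rw [mul_pow, Real.sq_sqrt hK]
    refine key.trans (mul_le_mul_of_nonneg_left ?_ hK)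
    nlinarith [sq_nonneg ‖x.snd.fst‖]
  exact (sq_le_sq₀ (norm_nonneg _) (by positivity)).1 hle

end Smooth

/-! ### Closures of subspaces and graphs -/

/-- The bound passes to the closure, on which the first projection is then antilipschitz. So its
range is closed, which gives existence, and by linearity its fibres are single points. -/
theorem existsUnique_of_graph_bound {E F : Type*} [NormedAddCommGroup E] [NormedSpace ℝ E]
    [NormedAddCommGroup F] [NormedSpace ℝ F] [CompleteSpace E] [CompleteSpace F]
    (S : Submodule ℝ (E × F)) {K : ℝ} (hK : ∀ z ∈ S, ‖z.2‖ ≤ K * ‖z.1‖) {x : E}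
    (hx : x ∈ closure (Prod.fst '' (S : Set (E × F)))) :
    ∃! g, (x, g) ∈ closure (S : Set (E × F)) := by
  have hK' : ∀ z ∈ S.topologicalClosure, ‖z.2‖ ≤ K * ‖z.1‖ := by
    intro z hz
    exact closure_minimal (t := {z : E × F | ‖z.2‖ ≤ K * ‖z.1‖}) hK
      (isClosed_le (by fun_prop) (by fun_prop)) hz
  have : CompleteSpace S.topologicalClosure := S.isClosed_topologicalClosure.completeSpace_coe
  let T : S.topologicalClosure →L[ℝ] E :=
    (ContinuousLinearMap.fst ℝ E F).comp S.topologicalClosure.subtypeL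
  have hT : AntilipschitzWith (Real.toNNReal (max 1 K)) T := by
    refine AddMonoidHomClass.antilipschitz_of_bound T fun z => ?_
    rw [Real.coe_toNNReal _ (by positivity)]
    have h1 := hK' z z.2
    change max ‖(z : E × F).1‖ ‖(z : E × F).2‖ ≤ max 1 K * ‖(z : E × F).1‖
    have h2 : 1 * ‖(z : E × F).1‖ ≤ max 1 K * ‖(z : E × F).1‖ := by
      gcongr; exact le_max_left _ _
    have h3 : K * ‖(z : E × F).1‖ ≤ max 1 K * ‖(z : E × F).1‖ := by
      gcongr; exact le_max_right _ _
    exact max_le (by linarith) (by linarith)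
  have hcl : IsClosed (range T) := hT.isClosed_range T.uniformContinuous
  have hsub : Prod.fst '' (S : Set (E × F)) ⊆ range T := by
    rintro _ ⟨z, hz, rfl⟩
    exact ⟨⟨z, S.le_topologicalClosure hz⟩, rfl⟩
  obtain ⟨⟨z, hz⟩, rfl⟩ := closure_minimal hsub hcl hx
  refine ⟨z.2, hz, fun g hg => ?_⟩
  have h0 : (z.1, g) - z ∈ S.topologicalClosure := Submodule.sub_mem _ hg hz
  have h1 := hK' _ h0
  simp only [Prod.fst_sub, Prod.snd_sub, sub_self, norm_zero, mul_zero] at h1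
  exact sub_eq_zero.1 (norm_le_zero_iff.1 h1)

theorem mem_of_isClosed_of_generators {E : Type*} [NormedAddCommGroup E] [NormedSpace ℝ E]
    {s : Set E} (Q : Submodule ℝ (Submodule.span ℝ s).topologicalClosure)
    (hQ : IsClosed (Q : Set (Submodule.span ℝ s).topologicalClosure))
    (hs : ∀ x (hx : x ∈ (Submodule.span ℝ s).topologicalClosure), x ∈ s → ⟨x, hx⟩ ∈ Q)
    (x : (Submodule.span ℝ s).topologicalClosure) : x ∈ Q := by
  have h1 : Submodule.span ℝ s ≤ Q.map (Submodule.span ℝ s).topologicalClosure.subtype := by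
    rw [Submodule.span_le]
    intro y hy
    exact ⟨⟨y, Submodule.le_topologicalClosure _ (Submodule.subset_span hy)⟩,
      hs y _ hy, rfl⟩
  have h2 : x ∈ closure (Q : Set (Submodule.span ℝ s).topologicalClosure) := by
    rw [closure_subtype]
    exact closure_mono h1 x.2
  rwa [hQ.closure_eq] at h2

/-! ### Elements of H as functions, and products φ ⊗ h in H -/

section Elements

variable {d : ℕ} {Γ : Set (Eu d)} {c : Coefficients}

instance : CompleteSpace (H1 Γ) :=
  (Submodule.isClosed_topologicalClosure _).completeSpace_coe

set_option synthInstance.maxHeartbeats 200000 in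
instance : NormedSpace ℝ (WithLp 2 (CylL2Vec Γ × H1 Γ)) := inferInstance

set_option synthInstance.maxHeartbeats 200000 in
instance : NormedSpace ℝ (Ambient Γ) := inferInstance

set_option synthInstance.maxHeartbeats 200000 in
instance : CompleteSpace (Ambient Γ) := inferInstance

variable (Γ) in
/-- The continuous linear inclusion `H¹(Γ) → L²(Γ)`. -/
def h1valL : H1 Γ →L[ℝ] L2 Γ :=
  (WithLp.fstL 2 ℝ (L2 Γ) (L2Vec Γ)).comp (H1 Γ).subtypeL

variable (Γ) in
/-- The surface gradient as a continuous linear map. -/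
def h1gradL : H1 Γ →L[ℝ] L2Vec Γ :=
  (WithLp.sndL 2 ℝ (L2 Γ) (L2Vec Γ)).comp (H1 Γ).subtypeL

theorem h1valL_apply (h : H1 Γ) : h1valL Γ h = h1val h := rfl

variable [IsFiniteMeasure (surfaceMeasure Γ)]

/-- Every element of `H` is realised by a unique square-integrable function. -/
theorem existsUnique_isRealisation (hΓ : IsClosedHypersurface Γ) (hc : c.Admissible)
    (f : EnergySpace Γ c) : ∃! g : CylL2 Γ, IsRealisation f g := by
  obtain ⟨K, hK, hb⟩ := smoothGraph_bound (Γ := Γ) hc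
  refine existsUnique_of_graph_bound (smoothGraph Γ hc) hb ?_
  have hle : Submodule.span ℝ {x | ∃ f, IsSmoothElement Γ c f x} ≤
      (smoothGraph Γ hc).map (LinearMap.fst ℝ _ _) := by
    rw [Submodule.span_le]
    rintro x ⟨φ, hφ⟩
    obtain ⟨g, hg⟩ := hφ.exists_mem_graph hΓ hc
    exact ⟨(x, g), hg, rfl⟩
  exact closure_mono hle f.2

theorem mem_energySpace_of_mem_closure (hc : c.Admissible) {z : Ambient Γ × CylL2 Γ}
    (hz : z ∈ closure (smoothGraph Γ hc : Set (Ambient Γ × CylL2 Γ))) :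
    z.1 ∈ EnergySpace Γ c := by
  refine map_mem_closure continuous_fst hz ?_
  rintro w ⟨φ, hφ, -⟩
  exact Submodule.subset_span ⟨φ, hφ⟩

/-- The element `(p ⊗ h, q ⊗ ∇h, r h)` of the ambient space together with `g ⊗ h`. -/
def tensElem (p q : Lp ℝ 2 ivl) (r : ℝ) (g : Lp ℝ 2 ivl) : H1 Γ →L[ℝ] Ambient Γ × CylL2 Γ :=
  ContinuousLinearMap.prod
    ((WithLp.prodContinuousLinearEquiv 2 ℝ (CylL2 Γ)
        (WithLp 2 (CylL2Vec Γ × H1 Γ))).symm.toContinuousLinearMap.comp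
      (((cylTens Γ ℝ).flip p ∘L h1valL Γ).prod
        ((WithLp.prodContinuousLinearEquiv 2 ℝ (CylL2Vec Γ)
            (H1 Γ)).symm.toContinuousLinearMap.comp
          (((cylTens Γ (Eu d)).flip q ∘L h1gradL Γ).prod (r • ContinuousLinearMap.id ℝ (H1 Γ))))))
    ((cylTens Γ ℝ).flip g ∘L h1valL Γ)

/-- `(p, q, r, g) = (√𝖺 φ', √𝗆 φ, 𝒞 φ, φ)` for the smooth function `φ` of `u`. -/
structure IsProfile (c : Coefficients) (φ : ℝ → ℝ) (p q : Lp ℝ 2 ivl) (r : ℝ)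
    (g : Lp ℝ 2 ivl) : Prop where
  smooth : ContDiff ℝ ∞ φ
  deriv_eq : p =ᵐ[ivl] fun u => √(c.sa u) * deriv φ u
  mul_eq : q =ᵐ[ivl] fun u => √(c.sm u) * φ u
  constraint_eq : r = c.constraintOne φ
  val_eq : g =ᵐ[ivl] φ

/-- For smooth ψ the product φ(u)ψ(s) is itself a smooth element with these components. Such ψ
generate H¹(Γ) and everything is continuous in h, so the closure contains the rest. -/
theorem IsProfile.tensElem_mem {φ : ℝ → ℝ} {p q : Lp ℝ 2 ivl} {r : ℝ}
    {g : Lp ℝ 2 ivl} (hc : c.Admissible) (hφ : IsProfile c φ p q r g) (h : H1 Γ) :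
    tensElem p q r g h ∈ closure (smoothGraph Γ hc : Set (Ambient Γ × CylL2 Γ)) := by
  refine mem_of_isClosed_of_generators
    ((smoothGraph Γ hc).topologicalClosure.comap (tensElem p q r g).toLinearMap)
    ((smoothGraph Γ hc).isClosed_topologicalClosure.preimage (tensElem p q r g).continuous) ?_ h
  rintro x hx ⟨ψ, hψ, hx1, hx2⟩
  refine Submodule.le_topologicalClosure _ ?_
  have hx1' : h1val (Γ := Γ) ⟨x, hx⟩ =ᵐ[surfaceMeasure Γ] ψ := hx1
  have hx2' : h1grad (Γ := Γ) ⟨x, hx⟩ =ᵐ[surfaceMeasure Γ] surfaceGradient Γ ψ := hx2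
  have hd : ∀ s u, deriv (fun v => φ v * ψ s) u = deriv φ u * ψ s := fun s u =>
    deriv_mul_const_field _
  refine ⟨fun z => φ z.2 * ψ z.1, ⟨(hφ.smooth.comp contDiff_snd).mul (hψ.comp contDiff_fst),
    ?_, ?_, ?_⟩, ?_⟩
  · filter_upwards [cylTens_coe (h1val (Γ := Γ) ⟨x, hx⟩) p, ae_cyl_of_ae_ivl hφ.deriv_eq,
      ae_cyl_of_ae_surface hx1'] with z h1 h2 h3
    refine h1.trans ?_
    rw [h2, h3, hd, smul_eq_mul, mul_assoc]
  · filter_upwards [cylTens_coe (h1grad (Γ := Γ) ⟨x, hx⟩) q, ae_cyl_of_ae_ivl hφ.mul_eq,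
      ae_cyl_of_ae_surface hx2'] with z h1 h2 h3
    refine h1.trans ?_
    rw [h2, h3, surfaceGradient_const_mul _ (hψ.differentiable (by simp) _), smul_smul]
  · have e : h1val (r • (⟨x, hx⟩ : H1 Γ)) = r • h1val (Γ := Γ) ⟨x, hx⟩ := rfl
    have hcoe : (tensElem p q r g (⟨x, hx⟩ : H1 Γ)).1.snd.snd = r • (⟨x, hx⟩ : H1 Γ) := rfl
    change h1val (r • (⟨x, hx⟩ : H1 Γ)) =ᵐ[surfaceMeasure Γ] _
    rw [e]
    filter_upwards [Lp.coeFn_smul r (h1val (Γ := Γ) ⟨x, hx⟩), hx1'] with s h1 h2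
    rw [h1, Pi.smul_apply, h2, hφ.constraint_eq, smul_eq_mul, Coefficients.constraintOne,
      constraintFun, ← intervalIntegral.integral_mul_const]
    refine intervalIntegral.integral_congr fun u _ => ?_
    simp only [hd]
    ring
  · filter_upwards [cylTens_coe (h1val (Γ := Γ) ⟨x, hx⟩) g, ae_cyl_of_ae_ivl hφ.val_eq,
      ae_cyl_of_ae_surface hx1'] with z h1 h2 h3
    refine h1.trans ?_
    rw [h2, h3, smul_eq_mul]

end Elements

section Average

variable {d : ℕ} {Γ : Set (Eu d)} {c : Coefficients} [IsFiniteMeasure (surfaceMeasure Γ)]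

/-! ### Averages of smooth functions against square-integrable functions on the surface -/

/-- The function `u ↦ ∫ b(s) f(s, u)`. -/
def average (b : L2 Γ) (f : Eu d × ℝ → ℝ) (u : ℝ) : ℝ :=
  ∫ s, b s * f (s, u) ∂(surfaceMeasure Γ)

theorem hasDerivAt_average (hΓ : IsClosedHypersurface Γ) (b : L2 Γ) {f : Eu d × ℝ → ℝ}
    (hf : ContDiff ℝ ∞ f) (u : ℝ) :
    HasDerivAt (average b f) (average b (fun p => deriv (fun v => f (p.1, v)) p.2) u) u := by
  have hdf := contDiff_vertical_deriv hf
  have hb : Integrable b (surfaceMeasure Γ) := (Lp.memLp b).integrable (by norm_num)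
  obtain ⟨C, hC⟩ := (hΓ.isCompact.prod (isCompact_closedBall u 1)).exists_bound_of_continuousOn
    hdf.continuous.continuousOn
  refine (hasDerivAt_integral_of_dominated_loc_of_deriv_le (bound := fun s => ‖b s‖ * C)
    (F := fun v s => b s * f (s, v))
    (F' := fun v s => b s * deriv (fun v => f (s, v)) v)
    (Metric.closedBall_mem_nhds u one_pos) (Eventually.of_forall fun v => ?_) ?_ ?_ ?_
    (hb.norm.mul_const C) ?_).2
  · exact hb.1.mul (contDiff_slice hf v).continuous.aestronglyMeasurable
  · exact (Lp.memLp b).integrable_mul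
      (Continuous.memLp_surface hΓ (contDiff_slice hf u).continuous)
  · exact hb.1.mul (contDiff_slice hdf u).continuous.aestronglyMeasurable
  · filter_upwards [hΓ.ae_mem] with s hs v hv
    rw [norm_mul]
    exact mul_le_mul_of_nonneg_left (hC (s, v) ⟨hs, hv⟩) (norm_nonneg _)
  · refine Eventually.of_forall fun s v _ => ?_
    have h := (vertical_deriv_eq hf (s, v)).differentiableAt.hasDerivAt
    exact h.const_mul (b s)

/-- The derivative of an average is the average of ∂_u f, so induction on the order applies, for all
f at once. -/
theorem contDiff_average (hΓ : IsClosedHypersurface Γ) (b : L2 Γ) {f : Eu d × ℝ → ℝ}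
    (hf : ContDiff ℝ ∞ f) : ContDiff ℝ ∞ (average b f) := by
  rw [contDiff_infty]
  intro n
  induction n generalizing f with
  | zero =>
    exact contDiff_zero.2 (continuous_iff_continuousAt.2 fun u =>
      (hasDerivAt_average hΓ b hf u).continuousAt)
  | succ n ih =>
    rw [Nat.cast_add, Nat.cast_one, contDiff_succ_iff_deriv]
    refine ⟨fun u => (hasDerivAt_average hΓ b hf u).differentiableAt, by simp, ?_⟩
    rw [show deriv (average b f) = average b (fun p => deriv (fun v => f (p.1, v)) p.2) from
      funext fun u => (hasDerivAt_average hΓ b hf u).deriv]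
    exact ih (contDiff_vertical_deriv hf)

/-- The constant function `1` in `L²(-1,1)`. -/
def oneL2 : Lp ℝ 2 ivl := (memLp_const (1 : ℝ)).toLp _

/-- The weight `(n / n') / √𝖺` in `L²(-1,1)`. -/
def weightL2 (hc : c.Admissible) : Lp ℝ 2 ivl :=
  ((Coefficients.memLp_weight hc).mono_exponent le_top).toLp _

/-- Writing n/n' as weight times √𝖺 expresses the coefficient of 𝒞f by continuous functionals of f
and √𝖺 ∂_u f, so the identity survives passage to the closure. -/
theorem constraint_relation_smooth (hc : c.Admissible) (b : L2 Γ) {z : Ambient Γ × CylL2 Γ}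
    (hz : z ∈ smoothGraph Γ hc) :
    ⟪b, h1val z.1.snd.snd⟫_ℝ =
      ⟪oneL2, cylPart b z.2⟫_ℝ + ⟪weightL2 hc, cylPart b z.1.fst⟫_ℝ := by
  obtain ⟨f, hf, hfg⟩ := hz
  rw [cylPart_inner, cylPart_inner, L2.inner_def, L2.inner_def, L2.inner_def,
    ← integral_add (L2.integrable_inner _ _) (L2.integrable_inner _ _)]
  have hI : Integrable (fun p => ⟪cylTens Γ ℝ b oneL2 p, z.2 p⟫_ℝ +
      ⟪cylTens Γ ℝ b (weightL2 hc) p, z.1.fst p⟫_ℝ) ((surfaceMeasure Γ).prod ivl) :=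
    (L2.integrable_inner (𝕜 := ℝ) _ _).add (L2.integrable_inner (𝕜 := ℝ) _ _)
  refine Eq.trans ?_ (integral_prod _ hI).symm
  have hone : oneL2 =ᵐ[ivl] fun _ => (1 : ℝ) := MemLp.coeFn_toLp _
  have hwt : weightL2 hc =ᵐ[ivl] c.weight := MemLp.coeFn_toLp _
  refine integral_congr_ae ?_
  filter_upwards [hf.2.2.2, ae_surface_ae_ivl hf.2.1, ae_surface_ae_ivl hfg,
    ae_surface_ae_ivl (cylTens_coe b oneL2), ae_surface_ae_ivl (cylTens_coe b (weightL2 hc))]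
    with s h1 h2 h3 h4 h5
  rw [Real.inner_apply, h1, constraintFun, intervalIntegral_eq_ivl, ← integral_const_mul]
  refine integral_congr_ae ?_
  filter_upwards [h2, h3, h4, h5, hone, hwt, Coefficients.weight_mul_ae hc]
    with u g2 g3 g4 g5 g6 g7 g8
  rw [g2, g3, g4, g5, g6, g7, ← g8]
  simp only [smul_eq_mul, Real.inner_apply]
  ring

theorem constraint_relation (hc : c.Admissible) (b : L2 Γ) {z : Ambient Γ × CylL2 Γ}
    (hz : z ∈ closure (smoothGraph Γ hc : Set (Ambient Γ × CylL2 Γ))) :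
    ⟪b, h1val z.1.snd.snd⟫_ℝ =
      ⟪oneL2, cylPart b z.2⟫_ℝ + ⟪weightL2 hc, cylPart b z.1.fst⟫_ℝ := by
  refine closure_minimal (t := {z : Ambient Γ × CylL2 Γ | ⟪b, h1valL Γ z.1.snd.snd⟫_ℝ =
      ⟪oneL2, cylPart b z.2⟫_ℝ + ⟪weightL2 hc, cylPart b z.1.fst⟫_ℝ})
    (fun z hz => constraint_relation_smooth hc b hz) (isClosed_eq ?_ ?_) hz
  · have := (h1valL Γ).continuous
    fun_prop
  · have h1 := (cylPart (E := ℝ) b).continuous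
    fun_prop

/-- The eigenvalue equation tested with almost every slice of a smooth element. -/
theorem IsSmoothElement.integral_inner_grad (hΓ : IsClosedHypersurface Γ) (hc : c.Admissible)
    {e : H1 Γ} {l : ℝ} (he : IsNegLaplacian e (l • h1val e)) {f : Eu d × ℝ → ℝ} {x : Ambient Γ}
    (hf : IsSmoothElement Γ c f x) :
    ∀ᵐ u ∂ivl, ∫ s, ⟪h1grad e s, x.snd.fst (s, u)⟫_ℝ ∂(surfaceMeasure Γ) =
      l * (√(c.sm u) * average (h1val e) f u) := by
  have hsq : Integrable (fun z => ‖x.snd.fst z‖ ^ 2) ((surfaceMeasure Γ).prod ivl) :=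
    (memLp_two_iff_integrable_sq_norm (Lp.memLp x.snd.fst).1).1 (Lp.memLp x.snd.fst)
  filter_upwards [hsq.prod_left_ae, ae_ivl_ae_surface hf.2.2.1, ae_ivl_mem_Ioo] with u h1 h2 hu
  have hsm : √(c.sm u) ≠ 0 := (Real.sqrt_pos.2 (Coefficients.sm_pos hc hu)).ne'
  have hmeas : AEStronglyMeasurable (fun s => x.snd.fst (s, u)) (surfaceMeasure Γ) :=
    ((Lp.stronglyMeasurable x.snd.fst).comp_measurable
      measurable_prodMk_right).aestronglyMeasurable
  have hx : MemLp (fun s => x.snd.fst (s, u)) 2 (surfaceMeasure Γ) :=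
    (memLp_two_iff_integrable_sq_norm hmeas).2 h1
  -- Dividing by √𝗆 > 0 shows that almost every slice belongs to H¹(Γ), hence is admissible as a
  -- test function in the eigenvalue equation.
  have hgrad : MemLp (surfaceGradient Γ fun s => f (s, u)) 2 (surfaceMeasure Γ) := by
    refine (hx.const_smul (√(c.sm u))⁻¹).ae_eq ?_
    filter_upwards [h2] with s hs
    rw [Pi.smul_apply, hs, smul_smul, inv_mul_cancel₀ hsm, one_smul]
  have hval : MemLp (fun s => f (s, u)) 2 (surfaceMeasure Γ) :=
    Continuous.memLp_surface hΓ (contDiff_slice hf.1 u).continuous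
  let h : H1 Γ := ⟨WithLp.toLp 2 (hval.toLp _, hgrad.toLp _),
    Submodule.le_topologicalClosure _ (Submodule.subset_span
      ⟨_, contDiff_slice hf.1 u, hval.coeFn_toLp, hgrad.coeFn_toLp⟩)⟩
  have hh1 : h1val h =ᵐ[surfaceMeasure Γ] fun s => f (s, u) := hval.coeFn_toLp
  have hh2 : h1grad h =ᵐ[surfaceMeasure Γ] surfaceGradient Γ fun s => f (s, u) :=
    hgrad.coeFn_toLp
  have key := he h
  rw [real_inner_smul_left, L2.inner_def, L2.inner_def] at key
  have e1 : ∫ s, ⟪h1grad e s, x.snd.fst (s, u)⟫_ℝ ∂(surfaceMeasure Γ) =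
      √(c.sm u) * ∫ s, ⟪h1grad e s, h1grad h s⟫_ℝ ∂(surfaceMeasure Γ) := by
    rw [← integral_const_mul]
    refine integral_congr_ae ?_
    filter_upwards [h2, hh2] with s g1 g2
    rw [g1, g2, real_inner_smul_right]
  have e2 : ∫ s, ⟪h1val e s, h1val h s⟫_ℝ ∂(surfaceMeasure Γ) = average (h1val e) f u := by
    refine integral_congr_ae ?_
    filter_upwards [hh1] with s g1
    rw [g1, Real.inner_apply]
  rw [e1, key, e2]
  ring

/-- Averaging against e commutes with ∂_u and with the constraint. The pairing of the gradients
yields l√𝗆 times the average, which the factor l⁻¹ undoes. -/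
theorem isProfile_average (hΓ : IsClosedHypersurface Γ) (hc : c.Admissible)
    {e : H1 Γ} {l : ℝ} (hl : l ≠ 0) (he : IsNegLaplacian e (l • h1val e))
    {z : Ambient Γ × CylL2 Γ} {f : Eu d × ℝ → ℝ} (hf : IsSmoothElement Γ c f z.1)
    (hfg : z.2 =ᵐ[cylMeasure Γ] f) :
    IsProfile c (average (h1val e) f) (cylPart (h1val e) z.1.fst)
      (l⁻¹ • cylPart (h1grad e) z.1.snd.fst) ⟪h1val e, h1val z.1.snd.snd⟫_ℝ
      (cylPart (h1val e) z.2) := by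
  have hderiv : cylPart (h1val e) z.1.fst =ᵐ[ivl]
      fun u => √(c.sa u) * deriv (average (h1val e) f) u := by
    filter_upwards [cylPart_coe (h1val e) z.1.fst, ae_ivl_ae_surface hf.2.1] with u h1 h2
    rw [h1, (hasDerivAt_average hΓ _ hf.1 u).deriv, average, ← integral_const_mul]
    refine integral_congr_ae ?_
    filter_upwards [h2] with s hs
    rw [hs, Real.inner_apply]
    ring
  have hval : cylPart (h1val e) z.2 =ᵐ[ivl] average (h1val e) f := by
    filter_upwards [cylPart_coe (h1val e) z.2, ae_ivl_ae_surface hfg] with u h1 h2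
    rw [h1, average]
    refine integral_congr_ae ?_
    filter_upwards [h2] with s hs
    rw [hs, Real.inner_apply]
  have hsmooth := contDiff_average hΓ (h1val e) hf.1
  refine ⟨hsmooth, hderiv, ?_, ?_, hval⟩
  · filter_upwards [Lp.coeFn_smul l⁻¹ (cylPart (h1grad e) z.1.snd.fst),
      cylPart_coe (h1grad e) z.1.snd.fst, hf.integral_inner_grad hΓ hc he] with u h1 h2 h3
    rw [h1, Pi.smul_apply, h2, h3, smul_eq_mul, inv_mul_cancel_left₀ hl]
  · rw [constraint_relation_smooth hc (h1val e) ⟨f, hf, hfg⟩, L2.inner_def, L2.inner_def,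
      Coefficients.constraintOne, intervalIntegral_eq_ivl, integral_add]
    · congr 1
      · refine integral_congr_ae ?_
        have hone : oneL2 =ᵐ[ivl] fun _ => (1 : ℝ) := MemLp.coeFn_toLp _
        filter_upwards [hval, hone] with u h1 h2
        rw [h1, h2, Real.inner_apply, one_mul]
      · refine integral_congr_ae ?_
        have hwt : weightL2 hc =ᵐ[ivl] c.weight := MemLp.coeFn_toLp _
        filter_upwards [hderiv, hwt, Coefficients.weight_mul_ae hc] with u h1 h2 h3
        rw [h1, h2, Real.inner_apply, ← h3]
        ring
    · exact (Continuous.memLp_ivl hsmooth.continuous 1).integrable le_rfl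
    · exact (Coefficients.memLp_ratio_mul hc
        ((Lp.memLp (cylPart (h1val e) z.1.fst)).ae_eq hderiv)).integrable (by norm_num)

/-- The map that sends the `e`-component `φ ⊗ e` of a function on the cylinder to `φ ⊗ e'`. -/
def transfer (e e' : H1 Γ) (l : ℝ) (z : Ambient Γ × CylL2 Γ) : Ambient Γ × CylL2 Γ :=
  tensElem (cylPart (h1val e) z.1.fst) (l⁻¹ • cylPart (h1grad e) z.1.snd.fst)
    ⟪h1val e, h1val z.1.snd.snd⟫_ℝ (cylPart (h1val e) z.2) e'

theorem continuous_transfer (e e' : H1 Γ) (l : ℝ) : Continuous (transfer e e' l) := by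
  have c1 : Continuous fun z : Ambient Γ × CylL2 Γ => z.1.fst := by fun_prop
  have c2 : Continuous fun z : Ambient Γ × CylL2 Γ => z.1.snd.fst := by fun_prop
  have c3 : Continuous fun z : Ambient Γ × CylL2 Γ => z.1.snd.snd := by fun_prop
  have h1 : Continuous fun z : Ambient Γ × CylL2 Γ =>
      cylTens Γ ℝ (h1val e') (cylPart (h1val e) z.1.fst) :=
    (cylTens Γ ℝ (h1val e')).continuous.comp ((cylPart (h1val e)).continuous.comp c1)
  have h2 : Continuous fun z : Ambient Γ × CylL2 Γ =>
      cylTens Γ (Eu d) (h1grad e') (l⁻¹ • cylPart (h1grad e) z.1.snd.fst) :=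
    (cylTens Γ (Eu d) (h1grad e')).continuous.comp
      (((cylPart (h1grad e)).continuous.comp c2).const_smul l⁻¹)
  have h3 : Continuous fun z : Ambient Γ × CylL2 Γ => ⟪h1val e, h1valL Γ z.1.snd.snd⟫_ℝ • e' := by
    have c4 : Continuous fun z : Ambient Γ × CylL2 Γ => h1valL Γ z.1.snd.snd :=
      (h1valL Γ).continuous.comp c3
    fun_prop
  have h4 : Continuous fun z : Ambient Γ × CylL2 Γ =>
      cylTens Γ ℝ (h1val e') (cylPart (h1val e) z.2) :=
    (cylTens Γ ℝ (h1val e')).continuous.comp ((cylPart (h1val e)).continuous.comp continuous_snd)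
  exact ((WithLp.prod_continuous_toLp 2 _ _).comp (h1.prodMk
    ((WithLp.prod_continuous_toLp 2 _ _).comp (h2.prodMk h3)))).prodMk h4

/-- A smooth element is sent to the product of its averaged profile with e'; continuity of the
transfer does the rest. -/
theorem transfer_mem_closure (hΓ : IsClosedHypersurface Γ) (hc : c.Admissible)
    {e e' : H1 Γ} {l : ℝ} (hl : l ≠ 0) (he : IsNegLaplacian e (l • h1val e))
    {z : Ambient Γ × CylL2 Γ}
    (hz : z ∈ closure (smoothGraph Γ hc : Set (Ambient Γ × CylL2 Γ))) :
    transfer e e' l z ∈ closure (smoothGraph Γ hc : Set (Ambient Γ × CylL2 Γ)) := by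
  rw [← closure_closure (s := (smoothGraph Γ hc : Set (Ambient Γ × CylL2 Γ)))]
  refine map_mem_closure (continuous_transfer e e' l) hz ?_
  rintro w ⟨f, hf, hfg⟩
  exact (isProfile_average hΓ hc hl he hf hfg).tensElem_mem hc e'

/-- No bound on w is required: along a subsequence both components converge almost everywhere, and
the relation is pointwise. -/
theorem isClosed_setOf_ae_mul {α : Type*} [MeasurableSpace α] {m : Measure α} (w : α → ℝ) :
    IsClosed {P : Lp ℝ 2 m × Lp ℝ 2 m | P.1 =ᵐ[m] fun u => w u * P.2 u} := by
  refine IsSeqClosed.isClosed fun P Q hP hPQ => ?_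
  have h1 := tendstoInMeasure_of_tendsto_Lp ((continuous_fst.tendsto Q).comp hPQ)
  obtain ⟨ns, hns, h1'⟩ := h1.exists_seq_tendsto_ae
  have h2 := tendstoInMeasure_of_tendsto_Lp
    (((continuous_snd.tendsto Q).comp hPQ).comp hns.tendsto_atTop)
  obtain ⟨ms, hms, h2'⟩ := h2.exists_seq_tendsto_ae
  filter_upwards [h1', h2', ae_all_iff.2 hP] with u g1 g2 g3
  refine tendsto_nhds_unique (g1.comp hms.tendsto_atTop) ?_
  refine ((g2.const_mul (w u))).congr fun k => ?_
  simp only [Function.comp_apply]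
  exact (g3 _).symm

theorem cylPart_grad_ae (hΓ : IsClosedHypersurface Γ) (hc : c.Admissible)
    {e : H1 Γ} {l : ℝ} (he : IsNegLaplacian e (l • h1val e)) {z : Ambient Γ × CylL2 Γ}
    (hz : z ∈ closure (smoothGraph Γ hc : Set (Ambient Γ × CylL2 Γ))) :
    cylPart (h1grad e) z.1.snd.fst =ᵐ[ivl]
      fun u => l * √(c.sm u) * cylPart (h1val e) z.2 u := by
  have hcont : Continuous fun z : Ambient Γ × CylL2 Γ =>
      (cylPart (h1grad e) z.1.snd.fst, cylPart (h1val e) z.2) :=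
    ((cylPart (h1grad e)).continuous.comp (by fun_prop)).prodMk
      ((cylPart (h1val e)).continuous.comp continuous_snd)
  refine closure_minimal (t := {z : Ambient Γ × CylL2 Γ | cylPart (h1grad e) z.1.snd.fst =ᵐ[ivl]
      fun u => l * √(c.sm u) * cylPart (h1val e) z.2 u}) ?_
    ((isClosed_setOf_ae_mul fun u => l * √(c.sm u)).preimage hcont) hz
  rintro w ⟨f, hf, hfg⟩
  filter_upwards [cylPart_coe (h1grad e) w.1.snd.fst, hf.integral_inner_grad hΓ hc he,
    cylPart_coe (h1val e) w.2, ae_ivl_ae_surface hfg] with u h1 h2 h3 h4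
  rw [h1, h2, h3, mul_assoc]
  congr 2
  refine integral_congr_ae ?_
  filter_upwards [h4] with s hs
  rw [hs, Real.inner_apply]

end Average

/-! ### Constrained minimisation in Hilbert spaces -/

/-- X holds the constraint and M provides a lift with vanishing first component. The solution is the
lift minus its projection onto the part of K with zero constraint. T records that the middle
component depends linearly and continuously on the datum. -/
theorem exists_constrained_solver {A B X : Type*} [NormedAddCommGroup A] [InnerProductSpace ℝ A]
    [NormedAddCommGroup B] [InnerProductSpace ℝ B] [NormedAddCommGroup X] [InnerProductSpace ℝ X]
    [CompleteSpace A] [CompleteSpace B] [CompleteSpace X]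
    (K : Submodule ℝ (WithLp 2 (A × WithLp 2 (B × X))))
    (hK : IsClosed (K : Set (WithLp 2 (A × WithLp 2 (B × X)))))
    (M : X →L[ℝ] B) (hM : ∀ x, WithLp.toLp 2 ((0 : A), WithLp.toLp 2 (M x, x)) ∈ K) :
    ∃ (S : X → WithLp 2 (A × WithLp 2 (B × X))) (T : X →L[ℝ] B), ∀ x, S x ∈ K ∧
      (S x).snd.snd = x ∧ (S x).snd.fst = T x ∧
      (∃ V : StrongDual ℝ X, ∀ φ ∈ K,
        ⟪(S x).fst, φ.fst⟫_ℝ + ⟪(S x).snd.fst, φ.snd.fst⟫_ℝ = V φ.snd.snd) ∧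
      ∀ f ∈ K, ∀ V : StrongDual ℝ X, f.snd.snd = x →
        (∀ φ ∈ K, ⟪f.fst, φ.fst⟫_ℝ + ⟪f.snd.fst, φ.snd.fst⟫_ℝ = V φ.snd.snd) → f = S x := by
  set C : WithLp 2 (A × WithLp 2 (B × X)) →L[ℝ] X :=
    (WithLp.sndL 2 ℝ B X).comp (WithLp.sndL 2 ℝ A (WithLp 2 (B × X)))
  obtain ⟨L, hLM⟩ : ∃ L : X →L[ℝ] WithLp 2 (A × WithLp 2 (B × X)),
      ∀ x, L x = WithLp.toLp 2 (0, WithLp.toLp 2 (M x, x)) :=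
    ⟨(WithLp.prodContinuousLinearEquiv 2 ℝ A (WithLp 2 (B × X))).symm.toContinuousLinearMap.comp
      ((0 : X →L[ℝ] A).prod
        ((WithLp.prodContinuousLinearEquiv 2 ℝ B X).symm.toContinuousLinearMap.comp
          (M.prod (ContinuousLinearMap.id ℝ X)))), fun x => rfl⟩
  have hLK : ∀ x, L x ∈ K := fun x => hLM x ▸ hM x
  have hL : ∀ x, (L x).snd.snd = x := fun x => by rw [hLM]; rfl
  set N := K ⊓ C.ker
  have hN : IsClosed (N : Set (WithLp 2 (A × WithLp 2 (B × X)))) := hK.inter C.isClosed_ker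
  have : CompleteSpace N := hN.completeSpace_coe
  set S := L - N.starProjection.comp L with hS
  have hSK : ∀ x, S x ∈ K := fun x =>
    K.sub_mem (hLK x) (N.starProjection_apply_mem (L x)).1
  have hSx : ∀ x, (S x).snd.snd = x := fun x => by
    have h : C (N.starProjection (L x)) = 0 := (N.starProjection_apply_mem (L x)).2
    change (L x).snd.snd - C (N.starProjection (L x)) = x
    rw [h, hL, sub_zero]
  have horth : ∀ x, ∀ φ ∈ K, φ.snd.snd = 0 →
      ⟪(S x).fst, φ.fst⟫_ℝ + ⟪(S x).snd.fst, φ.snd.fst⟫_ℝ = 0 := fun x φ hφ hφ0 => by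
    have h : ⟪φ, S x⟫_ℝ = 0 := N.sub_starProjection_mem_orthogonal (L x) φ ⟨hφ, hφ0⟩
    rw [real_inner_comm, WithLp.prod_inner_apply, WithLp.prod_inner_apply] at h
    change ⟪(S x).fst, φ.fst⟫_ℝ + (⟪(S x).snd.fst, φ.snd.fst⟫_ℝ +
      ⟪(S x).snd.snd, φ.snd.snd⟫_ℝ) = 0 at h
    rwa [hφ0, inner_zero_right, add_zero] at h
  -- The energy of S x against φ equals that against the lift of the constraint of φ, since the
  -- difference has zero constraint. V is therefore the full inner product with this lift minus the
  -- constraint term.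
  refine ⟨S, (WithLp.fstL 2 ℝ B X).comp ((WithLp.sndL 2 ℝ A (WithLp 2 (B × X))).comp S),
    fun x => ⟨hSK x, hSx x, rfl, ⟨(innerSL ℝ (S x)).comp L - innerSL ℝ x,
    fun φ hφ => ?_⟩, fun f hf V hfx hV => ?_⟩⟩
  · have h := horth x (φ - L φ.snd.snd) (K.sub_mem hφ (hLK _)) (by simp [hL])
    have h2 : ⟪S x, L φ.snd.snd⟫_ℝ = ⟪(S x).fst, (L φ.snd.snd).fst⟫_ℝ +
      (⟪(S x).snd.fst, (L φ.snd.snd).snd.fst⟫_ℝ +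
        ⟪(S x).snd.snd, (L φ.snd.snd).snd.snd⟫_ℝ) := rfl
    rw [hSx, hL] at h2
    change _ = ⟪S x, L φ.snd.snd⟫_ℝ - ⟪x, φ.snd.snd⟫_ℝ
    rw [h2]
    simp only [WithLp.sub_fst, WithLp.sub_snd, inner_sub_right] at h
    linarith
  · have hmem : f - S x ∈ K := K.sub_mem hf (hSK x)
    have h0 : (f - S x).snd.snd = 0 := by
      rw [WithLp.sub_snd, WithLp.sub_snd, hfx, hSx, sub_self]
    have h1 := hV _ hmem
    have h2 := horth x _ hmem h0
    rw [h0, map_zero] at h1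
    have h3 : ⟪f - S x, f - S x⟫_ℝ = ⟪(f - S x).fst, (f - S x).fst⟫_ℝ +
      (⟪(f - S x).snd.fst, (f - S x).snd.fst⟫_ℝ + ⟪(f - S x).snd.snd, (f - S x).snd.snd⟫_ℝ) := rfl
    rw [h0, inner_zero_left] at h3
    -- The difference has zero constraint, so its squared norm is its energy, and both solutions
    -- have zero energy pairing with it.
    refine sub_eq_zero.1 (inner_self_eq_zero.1 (h3.trans ?_))
    have e1 : ⟪(f - S x).fst, (f - S x).fst⟫_ℝ =
        ⟪f.fst, (f - S x).fst⟫_ℝ - ⟪(S x).fst, (f - S x).fst⟫_ℝ := by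
      rw [← inner_sub_left, ← WithLp.sub_fst]
    have e2 : ⟪(f - S x).snd.fst, (f - S x).snd.fst⟫_ℝ =
        ⟪f.snd.fst, (f - S x).snd.fst⟫_ℝ - ⟪(S x).snd.fst, (f - S x).snd.fst⟫_ℝ := by
      rw [← inner_sub_left, ← WithLp.sub_fst, ← WithLp.sub_snd]
    rw [e1, e2]
    linarith

theorem summable_smul_orthonormal {X : Type*} [NormedAddCommGroup X] [InnerProductSpace ℝ X]
    [CompleteSpace X] {v : ℕ → X} (hv : Orthonormal ℝ v) {a : ℕ → ℝ}
    (ha : Summable fun k => a k ^ 2) : Summable fun k => a k • v k := by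
  have h := (hv.orthogonalFamily.summable_iff_norm_sq_summable a).2 (by simpa using ha)
  simpa using h

/-! ### Solvability of the constrained problem -/

section Solution

variable {d : ℕ} {Γ : Set (Eu d)} {c : Coefficients}

theorem H1.inner_eq (f g : H1 Γ) :
    ⟪f, g⟫_ℝ = ⟪h1val f, h1val g⟫_ℝ + ⟪h1grad f, h1grad g⟫_ℝ := rfl

theorem sigma_pos : 0 < sigma := by
  refine intervalIntegral.intervalIntegral_pos_of_pos_on
    (Continuous.intervalIntegrable (by fun_prop) _ _) (fun u hu => ?_) (by norm_num)
  exact Real.sqrt_pos.2 (Coefficients.one_sub_sq_pos hu)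

/-- The function `√𝗆 / 2` in `L²(-1,1)`. -/
def halfSqrtSm (hc : c.Admissible) : Lp ℝ 2 ivl :=
  ((Coefficients.memLp_sqrt_sm hc).mul_const (1 / 2)).toLp _

theorem halfSqrtSm_coe (hc : c.Admissible) :
    halfSqrtSm hc =ᵐ[ivl] fun u => √(c.sm u) * (1 / 2) :=
  MemLp.coeFn_toLp _

/-- The interval has length 2, so the constant 1/2 has constraint 1, and h/2 is a lift of h with
zero vertical derivative. -/
theorem isProfile_half (hc : c.Admissible) :
    IsProfile c (fun _ => 1 / 2) 0 (halfSqrtSm hc) 1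
      ((memLp_const (1 / 2 : ℝ)).toLp _) := by
  refine ⟨contDiff_const, ?_, halfSqrtSm_coe hc, ?_, MemLp.coeFn_toLp _⟩
  · filter_upwards [Lp.coeFn_zero ℝ 2 ivl] with u hu
    rw [hu]
    simp
  · simp [Coefficients.constraintOne]
    norm_num

theorem isSolution_mk_iff {κ : H1 Γ} {x : Ambient Γ} (hx : x ∈ EnergySpace Γ c)
    {V : StrongDual ℝ (H1 Γ)} :
    IsSolution κ ((⟨x, hx⟩ : EnergySpace Γ c), V) ↔ x.snd.snd = sigma • κ ∧
      ∀ φ ∈ EnergySpace Γ c,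
        ⟪x.fst, φ.fst⟫_ℝ + ⟪x.snd.fst, φ.snd.fst⟫_ℝ = V φ.snd.snd :=
  ⟨fun h => ⟨h.1, fun φ hφ => h.2 ⟨φ, hφ⟩⟩, fun h => ⟨h.1, fun φ => h.2 φ.1 φ.2⟩⟩

variable [IsFiniteMeasure (surfaceMeasure Γ)]

theorem half_mem_energySpace (hc : c.Admissible) (h : H1 Γ) :
    (WithLp.toLp 2 ((0 : CylL2 Γ), WithLp.toLp 2
      (((cylTens Γ (Eu d)).flip (halfSqrtSm hc) ∘L h1gradL Γ) h, h)) : Ambient Γ) ∈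
      EnergySpace Γ c := by
  have h1 := mem_energySpace_of_mem_closure hc ((isProfile_half hc).tensElem_mem hc h)
  have h2 : (tensElem 0 (halfSqrtSm hc) 1 ((memLp_const (1 / 2 : ℝ)).toLp _) h).1 =
      (WithLp.toLp 2 (cylTens Γ ℝ (h1val h) 0, WithLp.toLp 2
        (cylTens Γ (Eu d) (h1grad h) (halfSqrtSm hc), (1 : ℝ) • h)) : Ambient Γ) := rfl
  rw [map_zero, one_smul] at h2
  rw [h2] at h1
  exact h1

theorem exists_energySolver (Γ : Set (Eu d)) [IsFiniteMeasure (surfaceMeasure Γ)]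
    (hc : c.Admissible) :
    ∃ (S : H1 Γ → Ambient Γ) (T : H1 Γ →L[ℝ] CylL2Vec Γ), ∀ x, S x ∈ EnergySpace Γ c ∧
      (S x).snd.snd = x ∧ (S x).snd.fst = T x ∧
      (∃ V : StrongDual ℝ (H1 Γ), ∀ φ ∈ EnergySpace Γ c,
        ⟪(S x).fst, φ.fst⟫_ℝ + ⟪(S x).snd.fst, φ.snd.fst⟫_ℝ = V φ.snd.snd) ∧
      ∀ f ∈ EnergySpace Γ c, ∀ V : StrongDual ℝ (H1 Γ), f.snd.snd = x →
        (∀ φ ∈ EnergySpace Γ c,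
          ⟪f.fst, φ.fst⟫_ℝ + ⟪f.snd.fst, φ.snd.fst⟫_ℝ = V φ.snd.snd) → f = S x :=
  exists_constrained_solver (EnergySpace Γ c) (Submodule.isClosed_topologicalClosure _)
    _ (half_mem_energySpace hc)

/-- The second component of a solution is determined by the first one. -/
theorem IsSolution.snd_apply (hc : c.Admissible) {κ : H1 Γ}
    {p : EnergySpace Γ c × StrongDual ℝ (H1 Γ)} (hp : IsSolution κ p) (ψ : H1 Γ) :
    p.2 ψ = ⟪cylPart (h1grad ψ) (p.1 : Ambient Γ).snd.fst, halfSqrtSm hc⟫_ℝ := by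
  obtain ⟨⟨x, hx⟩, W⟩ := p
  have h : ⟪x.fst, (0 : CylL2 Γ)⟫_ℝ +
      ⟪x.snd.fst, cylTens Γ (Eu d) (h1grad ψ) (halfSqrtSm hc)⟫_ℝ = W ψ :=
    ((isSolution_mk_iff hx).1 hp).2 _ (half_mem_energySpace hc ψ)
  rw [inner_zero_right, zero_add, ← inner_cylPart] at h
  exact h.symm

set_option maxHeartbeats 1000000 in
theorem exists_solutionOperator (Γ : Set (Eu d)) [IsFiniteMeasure (surfaceMeasure Γ)]
    (hc : c.Admissible) :
    ∃ (S : H1 Γ → Ambient Γ) (T : H1 Γ →L[ℝ] CylL2Vec Γ), ∀ κ : H1 Γ,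
      (S κ).snd.fst = T κ ∧
      (∃ p : EnergySpace Γ c × StrongDual ℝ (H1 Γ), IsSolution κ p) ∧
      ∀ p : EnergySpace Γ c × StrongDual ℝ (H1 Γ), IsSolution κ p →
        (p.1 : Ambient Γ) = S κ := by
  obtain ⟨S, T, hS⟩ := exists_energySolver Γ hc
  refine ⟨fun κ => S (sigma • κ), sigma • T, fun κ => ?_⟩
  obtain ⟨hmem, hC, hT, ⟨V, hV⟩, huniq⟩ := hS (sigma • κ)
  have h1 : IsSolution κ ((⟨_, hmem⟩ : EnergySpace Γ c), V) := (isSolution_mk_iff hmem).2 ⟨hC, hV⟩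
  refine ⟨?_, ⟨_, h1⟩, ?_⟩
  · have := (map_smul T sigma κ)
    exact hT.trans this
  rintro ⟨⟨x, hx⟩, W⟩ hp
  obtain ⟨h1, h2⟩ := (isSolution_mk_iff hx).1 hp
  exact huniq x hx W h1 h2

theorem existsUnique_isSolution (hc : c.Admissible) (κ : H1 Γ) :
    ∃! p : EnergySpace Γ c × StrongDual ℝ (H1 Γ), IsSolution κ p := by
  obtain ⟨S, T, hS⟩ := exists_solutionOperator Γ hc
  obtain ⟨-, ⟨q, hq⟩, huniq⟩ := hS κ
  refine ⟨q, hq, fun p hp => ?_⟩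
  have h1 : p.1 = q.1 := Subtype.ext ((huniq p hp).trans (huniq q hq).symm)
  refine Prod.ext h1 (ContinuousLinearMap.ext fun ψ => ?_)
  rw [hp.snd_apply hc, hq.snd_apply hc, h1]

theorem isSolution_solF (hc : c.Admissible) (κ : H1 Γ) :
    IsSolution κ (solF c κ, propagation c κ) :=
  Classical.epsilon_spec (existsUnique_isSolution hc κ).exists

theorem isRealisation_realisation (hΓ : IsClosedHypersurface Γ) (hc : c.Admissible)
    (f : EnergySpace Γ c) : IsRealisation f (realisation f) :=
  Classical.epsilon_spec (existsUnique_isRealisation hΓ hc f).exists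

/-- V tested with ψ involves only the gradient component of the solution, and that is T κ. -/
theorem exists_propagation_eq (hc : c.Admissible) (ψ : H1 Γ) :
    ∃ L : H1 Γ →L[ℝ] ℝ, ∀ κ, propagation c κ ψ = L κ := by
  obtain ⟨S, T, hS⟩ := exists_solutionOperator Γ hc
  refine ⟨(innerSL ℝ (halfSqrtSm hc)).comp ((cylPart (h1grad ψ)).comp T), fun κ => ?_⟩
  have h := (isSolution_solF hc κ).snd_apply hc ψ
  rw [(hS κ).2.2 _ (isSolution_solF hc κ), (hS κ).1, real_inner_comm] at h
  exact h

end Solution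

/-! ### Diagonalisation on the eigenspaces of the Laplace–Beltrami operator -/

section Spectral

variable {d : ℕ} {Γ : Set (Eu d)} {c : Coefficients}

theorem norm_h1grad_sq {e : H1 Γ} {l : ℝ} (he : IsNegLaplacian e (l • h1val e))
    (hn : ⟪h1val e, h1val e⟫_ℝ = 1) : ‖h1grad e‖ ^ 2 = l := by
  rw [← real_inner_self_eq_norm_sq, he e, real_inner_smul_left, hn, mul_one]

theorem IsEigenbasis.inner_self {e : ℕ → H1 Γ} {lam : ℕ → ℝ} (he : IsEigenbasis e lam) (k : ℕ) :
    ⟪h1val (e k), h1val (e k)⟫_ℝ = 1 := by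
  rw [real_inner_self_eq_norm_sq, he.orthonormal.1 k, one_pow]

theorem IsEigenbasis.inner_ne {e : ℕ → H1 Γ} {lam : ℕ → ℝ} (he : IsEigenbasis e lam) {k l : ℕ}
    (h : k ≠ l) : ⟪h1val (e k), h1val (e l)⟫_ℝ = 0 :=
  he.orthonormal.2 h

/-- The functions e_k/√(1+λ_k) are orthonormal in H¹(Γ), so summability of (1+λ_k) a_k² suffices. -/
theorem IsEigenbasis.summable_h1 {e : ℕ → H1 Γ} {lam : ℕ → ℝ} (he : IsEigenbasis e lam)
    {a : ℕ → ℝ} (ha : Summable fun k => lam k ^ 2 * a k ^ 2) :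
    Summable fun k => a k • e k := by
  have hpos : ∀ k, 0 < 1 + lam k := fun k => by linarith [he.pos k]
  have hinner : ∀ k l, ⟪e k, e l⟫_ℝ = (1 + lam k) * ⟪h1val (e k), h1val (e l)⟫_ℝ := fun k l => by
    rw [H1.inner_eq, he.eigen k (e l), real_inner_smul_left]; ring
  have hsmul : ∀ (a b : ℝ) (x y : H1 Γ), ⟪a • x, b • y⟫_ℝ = a * (b * ⟪x, y⟫_ℝ) := fun a b x y =>
    (real_inner_smul_left x (b • y) a).trans (congrArg (a * ·) (real_inner_smul_right x y b))
  have horth : Orthonormal ℝ fun k => (√(1 + lam k))⁻¹ • e k := by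
    rw [orthonormal_iff_ite]
    intro k l
    rw [hsmul, hinner]
    split_ifs with h
    · subst h
      rw [he.inner_self]
      have h1 := Real.mul_self_sqrt (hpos k).le
      have h2 := (Real.sqrt_pos.2 (hpos k)).ne'
      field_simp
      nlinarith
    · rw [he.inner_ne h]; simp
  have h := summable_smul_orthonormal horth (a := fun k => √(1 + lam k) * a k) ?_
  · refine h.congr fun k => ?_
    have h2 := (Real.sqrt_pos.2 (hpos k)).ne'
    rw [smul_smul]
    congr 1
    field_simp
  · have h0 := he.pos 0
    -- Since λ_k ≥ λ_0, one has 1 ≤ (λ_k/λ_0)² and λ_k ≤ λ_k²/λ_0.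
    refine Summable.of_nonneg_of_le (fun k => sq_nonneg _) (fun k => ?_)
      (ha.mul_left ((1 / lam 0) ^ 2 + 1 / lam 0))
    have hk : lam 0 ≤ lam k := he.mono (Nat.zero_le k)
    rw [mul_pow, Real.sq_sqrt (hpos k).le, ← mul_assoc]
    refine mul_le_mul_of_nonneg_right ?_ (sq_nonneg _)
    have h1 : 1 ≤ 1 / lam 0 * lam k := by
      rw [one_div, inv_mul_eq_div, one_le_div h0]; exact hk
    have h2 : 0 < lam k := he.pos k
    nlinarith

variable [IsFiniteMeasure (surfaceMeasure Γ)]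

theorem mem_closure_of_isRealisation (hc : c.Admissible) {f : EnergySpace Γ c} {g : CylL2 Γ}
    (h : IsRealisation f g) :
    ((f : Ambient Γ), g) ∈ closure (smoothGraph Γ hc : Set (Ambient Γ × CylL2 Γ)) := h

theorem transfer_fst_fst (e e' : H1 Γ) (l : ℝ) (z : Ambient Γ × CylL2 Γ) :
    (transfer e e' l z).1.fst = cylTens Γ ℝ (h1val e') (cylPart (h1val e) z.1.fst) := rfl

theorem transfer_fst_snd_fst (e e' : H1 Γ) (l : ℝ) (z : Ambient Γ × CylL2 Γ) :
    (transfer e e' l z).1.snd.fst =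
      cylTens Γ (Eu d) (h1grad e') (l⁻¹ • cylPart (h1grad e) z.1.snd.fst) := rfl

theorem transfer_fst_snd_snd (e e' : H1 Γ) (l : ℝ) (z : Ambient Γ × CylL2 Γ) :
    (transfer e e' l z).1.snd.snd = ⟪h1val e, h1val z.1.snd.snd⟫_ℝ • e' := rfl

-- The energy of the transferred solution against φ is the energy of the original against φ
-- transferred from e' to e. That equals V applied to the constraint (e', 𝒞φ) e, hence the
-- multiplier.
set_option maxHeartbeats 1000000 in
theorem exists_transfer_isSolution (hΓ : IsClosedHypersurface Γ) (hc : c.Admissible)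
    {e e' : H1 Γ} {l : ℝ} (hl : l ≠ 0) (he : IsNegLaplacian e (l • h1val e))
    (he' : IsNegLaplacian e' (l • h1val e')) (hn : ⟪h1val e, h1val e⟫_ℝ = 1)
    {p : EnergySpace Γ c × StrongDual ℝ (H1 Γ)} (hp : IsSolution e p) {g : CylL2 Γ}
    (hg : IsRealisation p.1 g) :
    ∃ F : EnergySpace Γ c,
      IsRealisation F (cylTens Γ ℝ (h1val e') (cylPart (h1val e) g)) ∧
      IsSolution e' (F, p.2 e • (innerSL ℝ (h1val e')).comp (h1valL Γ)) := by
  obtain ⟨⟨x, hx⟩, V⟩ := p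
  obtain ⟨hp1, hp2⟩ := (isSolution_mk_iff hx).1 hp
  have hmem := transfer_mem_closure (e' := e') hΓ hc hl he (mem_closure_of_isRealisation hc hg)
  refine ⟨⟨_, mem_energySpace_of_mem_closure hc hmem⟩, hmem, (isSolution_mk_iff _).2 ⟨?_, ?_⟩⟩
  · rw [transfer_fst_snd_snd]
    change ⟪h1val e, h1valL Γ x.snd.snd⟫_ℝ • e' = sigma • e'
    rw [hp1, map_smul, h1valL_apply, real_inner_smul_right, hn, mul_one]
  · intro φ hφ
    -- The transfer acts on pairs, so φ must be accompanied by its realisation.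
    obtain ⟨gφ, hgφ, -⟩ := existsUnique_isRealisation hΓ hc ⟨φ, hφ⟩
    have hmem' := transfer_mem_closure (e' := e) hΓ hc hl he' (mem_closure_of_isRealisation hc hgφ)
    have h1 : ⟪x.fst, cylTens Γ ℝ (h1val e) (cylPart (h1val e') φ.fst)⟫_ℝ +
        ⟪x.snd.fst, cylTens Γ (Eu d) (h1grad e) (l⁻¹ • cylPart (h1grad e') φ.snd.fst)⟫_ℝ =
        V (⟪h1val e', h1val φ.snd.snd⟫_ℝ • e) :=
      hp2 _ (mem_energySpace_of_mem_closure hc hmem')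
    have hV : ∀ r : ℝ, V (r • e) = V e * r := fun r => by
      rw [map_smul, smul_eq_mul, mul_comm]
    rw [hV, ← inner_cylPart, ← inner_cylPart, real_inner_smul_right] at h1
    rw [transfer_fst_fst, transfer_fst_snd_fst, ← cylPart_inner, ← cylPart_inner,
      real_inner_smul_left]
    exact h1

/-- Allowing e' ≠ e within one eigenspace shows that the multiplier depends only on the eigenvalue.
-/
theorem propagation_eigen (hΓ : IsClosedHypersurface Γ) (hc : c.Admissible) {e e' : H1 Γ} {l : ℝ}
    (hl : l ≠ 0) (he : IsNegLaplacian e (l • h1val e))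
    (he' : IsNegLaplacian e' (l • h1val e')) (hn : ⟪h1val e, h1val e⟫_ℝ = 1) (ψ : H1 Γ) :
    propagation c e' ψ = propagation c e e * ⟪h1val e', h1val ψ⟫_ℝ := by
  obtain ⟨F, -, hF⟩ := exists_transfer_isSolution hΓ hc hl he he' hn (isSolution_solF hc e)
    (isRealisation_realisation hΓ hc _)
  have h := (existsUnique_isSolution hc e').unique (isSolution_solF hc e') hF
  have h2 : propagation c e' = _ := congrArg Prod.snd h
  rw [h2]
  rfl

/-- Transferring from e to itself again gives a solution with datum e, so by uniqueness ℱe equals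
its own e-component. -/
theorem realisation_eigen (hΓ : IsClosedHypersurface Γ) (hc : c.Admissible) {e : H1 Γ} {l : ℝ}
    (hl : l ≠ 0) (he : IsNegLaplacian e (l • h1val e))
    (hn : ⟪h1val e, h1val e⟫_ℝ = 1) :
    realisation (solF c e) =
      cylTens Γ ℝ (h1val e) (cylPart (h1val e) (realisation (solF c e))) := by
  obtain ⟨F, hF1, hF⟩ := exists_transfer_isSolution hΓ hc hl he he hn (isSolution_solF hc e)
    (isRealisation_realisation hΓ hc _)
  have h := (existsUnique_isSolution hc e).unique (isSolution_solF hc e) hF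
  have h2 : F = solF c e := (congrArg Prod.fst h).symm
  subst h2
  exact (existsUnique_isRealisation hΓ hc _).unique (isRealisation_realisation hΓ hc _) hF1

theorem coeffF_ae (e e' : H1 Γ) :
    coeffF c e e' =ᵐ[ivl] cylPart (h1val e') (realisation (solF c e)) := by
  filter_upwards [cylPart_coe (h1val e') (realisation (solF c e))] with u hu
  rw [hu, coeffF]
  simp only [Real.inner_apply, mul_comm]

theorem coeffF_eq_zero (hΓ : IsClosedHypersurface Γ) (hc : c.Admissible) {e e' : H1 Γ} {l : ℝ}
    (hl : l ≠ 0) (he : IsNegLaplacian e (l • h1val e))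
    (hn : ⟪h1val e, h1val e⟫_ℝ = 1) (ho : ⟪h1val e', h1val e⟫_ℝ = 0) :
    ∀ᵐ u ∂ivl, coeffF c e e' u = 0 := by
  have h : cylPart (h1val e') (realisation (solF c e)) = 0 := by
    rw [realisation_eigen hΓ hc hl he hn, cylPart_cylTens, ho, zero_smul]
  filter_upwards [coeffF_ae (c := c) e e', Lp.coeFn_zero ℝ 2 ivl] with u h1 h2
  rw [h1, h, h2, Pi.zero_apply]

theorem intervalIntegrable_and_propagation_eq (hΓ : IsClosedHypersurface Γ)
    (hc : c.Admissible) {e : H1 Γ} {l : ℝ} (he : IsNegLaplacian e (l • h1val e)) (hl : l ≠ 0) :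
    IntervalIntegrable (fun u => c.sm u * coeffF c e e u) volume (-1) 1 ∧
      propagation c e e = 1 / 2 * l * ∫ u in (-1 : ℝ)..1, c.sm u * coeffF c e e u := by
  set p := cylPart (h1grad e) (solF c e : Ambient Γ).snd.fst with hp
  have h1 := cylPart_grad_ae hΓ hc he
    (mem_closure_of_isRealisation hc (isRealisation_realisation hΓ hc (solF c e)))
  have hprod : ∀ᵐ u ∂ivl, ⟪p u, halfSqrtSm hc u⟫_ℝ =
      1 / 2 * l * (c.sm u * coeffF c e e u) := by
    filter_upwards [h1, halfSqrtSm_coe hc, coeffF_ae (c := c) e e, ae_ivl_mem_Ioo]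
      with u g0 g1 g2 hu
    have g0' : p u = l * √(c.sm u) * cylPart (h1val e) (realisation (solF c e)) u := g0
    rw [g0', g1, ← g2, Real.inner_apply]
    linear_combination 1 / 2 * l * coeffF c e e u *
      Real.mul_self_sqrt (Coefficients.sm_pos hc hu).le
  have hint : Integrable (fun u => 1 / 2 * l * (c.sm u * coeffF c e e u)) ivl :=
    (L2.integrable_inner (𝕜 := ℝ) p (halfSqrtSm hc)).congr hprod
  constructor
  · rw [intervalIntegrable_iff_integrableOn_Icc_of_le (by norm_num)]
    refine (hint.const_mul (1 / 2 * l)⁻¹).congr (Eventually.of_forall fun u => ?_)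
    exact inv_mul_cancel_left₀ (by positivity) _
  · rw [(isSolution_solF hc e).snd_apply hc e, intervalIntegral_eq_ivl, ← integral_const_mul,
      L2.inner_def]
    exact integral_congr_ae hprod

set_option maxHeartbeats 1000000 in
theorem energy_eq (hc : c.Admissible) (e : H1 Γ) :
    ‖(solF c e : Ambient Γ).fst‖ ^ 2 + ‖(solF c e : Ambient Γ).snd.fst‖ ^ 2 =
      sigma * propagation c e e := by
  have h := isSolution_solF hc e
  have h1 := h.2 (solF c e)
  have h2 : constraint (solF c e) = sigma • e := h.1
  rw [h2, map_smul, energyForm, real_inner_self_eq_norm_sq, real_inner_self_eq_norm_sq] at h1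
  exact h1

/-- A vanishing gradient part kills the e-component of the function, as l√𝗆 ≠ 0; with the vertical
derivative also zero, both terms of `constraint_relation` vanish. -/
theorem inner_constraint_eq_zero (hΓ : IsClosedHypersurface Γ) (hc : c.Admissible) {e : H1 Γ}
    {l : ℝ} (hl : l ≠ 0) (he : IsNegLaplacian e (l • h1val e)) {z : Ambient Γ × CylL2 Γ}
    (hz : z ∈ closure (smoothGraph Γ hc : Set (Ambient Γ × CylL2 Γ)))
    (h1 : z.1.fst = 0) (h2 : z.1.snd.fst = 0) : ⟪h1val e, h1val z.1.snd.snd⟫_ℝ = 0 := by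
  have h3 := cylPart_grad_ae hΓ hc he hz
  have h4 : cylPart (h1val e) z.2 = 0 := by
    ext1
    rw [h2, map_zero] at h3
    filter_upwards [h3, Lp.coeFn_zero ℝ 2 ivl, ae_ivl_mem_Ioo] with u g1 g2 hu
    rw [g2, Pi.zero_apply] at g1
    rw [g2, Pi.zero_apply]
    have := (Real.sqrt_pos.2 (Coefficients.sm_pos hc hu)).ne'
    exact (mul_eq_zero.1 g1.symm).resolve_left (mul_ne_zero hl this)
  have h5 := constraint_relation hc (h1val e) hz
  rw [h4, h1, map_zero, inner_zero_right, inner_zero_right, add_zero] at h5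
  exact h5

theorem propagation_pos (hΓ : IsClosedHypersurface Γ) (hc : c.Admissible) {e : H1 Γ} {l : ℝ}
    (hl : l ≠ 0) (he : IsNegLaplacian e (l • h1val e)) (hn : ⟪h1val e, h1val e⟫_ℝ = 1) :
    0 < propagation c e e := by
  by_contra! hle
  have hE := energy_eq hc e
  have hs := mul_nonpos_of_nonneg_of_nonpos sigma_pos.le hle
  have h1 : ‖(solF c e : Ambient Γ).fst‖ ^ 2 = 0 := by
    linarith [sq_nonneg ‖(solF c e : Ambient Γ).fst‖, sq_nonneg ‖(solF c e : Ambient Γ).snd.fst‖]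
  have h2 : ‖(solF c e : Ambient Γ).snd.fst‖ ^ 2 = 0 := by
    linarith [sq_nonneg ‖(solF c e : Ambient Γ).fst‖, sq_nonneg ‖(solF c e : Ambient Γ).snd.fst‖]
  have h5 := inner_constraint_eq_zero hΓ hc hl he
    (mem_closure_of_isRealisation hc (isRealisation_realisation hΓ hc (solF c e)))
    (norm_eq_zero.1 (pow_eq_zero_iff two_ne_zero |>.1 h1))
    (norm_eq_zero.1 (pow_eq_zero_iff two_ne_zero |>.1 h2))
  have h6 : (solF c e : Ambient Γ).snd.snd = sigma • e := (isSolution_solF hc e).1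
  have h7 : ⟪h1val e, h1val (solF c e : Ambient Γ).snd.snd⟫_ℝ = 0 := h5
  have h8 : h1val (sigma • e) = sigma • h1val e := map_smul (h1valL Γ) sigma e
  rw [h6, h8, real_inner_smul_right, hn, mul_one] at h7
  exact sigma_pos.ne' h7

-- For v = ⟨𝒢e, e⟩, Cauchy–Schwarz in the formula obtained by testing with e/2 bounds v² by the
-- energy σv times l‖√𝗆/2‖²; then v > 0 cancels.
set_option maxHeartbeats 1000000 in
theorem propagation_le (hc : c.Admissible) {e : H1 Γ} {l : ℝ} (hlpos : 0 ≤ l)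
    (he : IsNegLaplacian e (l • h1val e)) (hn : ⟪h1val e, h1val e⟫_ℝ = 1)
    (hpos : 0 < propagation c e e) :
    propagation c e e ≤ sigma * ‖halfSqrtSm hc‖ ^ 2 * l := by
  have h1 := (isSolution_solF hc e).snd_apply hc e
  rw [inner_cylPart] at h1
  have h2 := real_inner_le_norm (solF c e : Ambient Γ).snd.fst
    (cylTens Γ (Eu d) (h1grad e) (halfSqrtSm hc))
  have h3 : ‖cylTens Γ (Eu d) (h1grad e) (halfSqrtSm hc)‖ ^ 2 = l * ‖halfSqrtSm hc‖ ^ 2 := by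
    rw [← real_inner_self_eq_norm_sq, ← norm_h1grad_sq he hn, ← real_inner_self_eq_norm_sq,
      ← real_inner_self_eq_norm_sq]
    exact tens_inner _ _ _ _
  have hE := energy_eq hc e
  set v := propagation c e e
  have h1' : v ≤ _ := h1.le.trans h2
  have h4 : v ^ 2 ≤ sigma * v * (l * ‖halfSqrtSm hc‖ ^ 2) := by
    refine (pow_le_pow_left₀ hpos.le h1' 2).trans ?_
    rw [mul_pow, h3]
    refine mul_le_mul_of_nonneg_right ?_ (by positivity)
    nlinarith [sq_nonneg ‖(solF c e : Ambient Γ).fst‖]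
  have h5 : v * v ≤ v * (sigma * ‖halfSqrtSm hc‖ ^ 2 * l) := by nlinarith
  exact le_of_mul_le_mul_left h5 hpos

end Spectral

/-! ### The spectral symbol and summation of the series -/

section Symbol

variable {d : ℕ} {Γ : Set (Eu d)} {c : Coefficients} {e : ℕ → H1 Γ} {lam : ℕ → ℝ}

theorem IsSpectralSymbol.apply (he : IsEigenbasis e lam) {ζ : range lam → ℝ}
    (hζ : IsSpectralSymbol c e lam ζ) (k : ℕ) :
    ζ ⟨lam k, mem_range_self k⟩ = propagation c (e k) (e k) := by
  have hz : ∀ j, j ≠ k → (Pi.single k 1 : ℕ → ℝ) j = 0 := fun j hj => Pi.single_eq_of_ne hj 1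
  obtain ⟨h, hh, g, hg, hψ⟩ := hζ (Pi.single k 1) <|
    summable_of_ne_finset_zero (s := {k}) fun j hj => by
      rw [hz j (by simpa using hj)]; ring
  have h1 : h = e k := by
    refine hh.unique ?_
    have := hasSum_single (f := fun j => (Pi.single k 1 : ℕ → ℝ) j • e j) k
      fun j hj => by rw [hz j hj, zero_smul]
    simpa only [Pi.single_eq_same, one_smul] using this
  have h2 : g = ζ ⟨lam k, mem_range_self k⟩ • h1val (e k) := by
    refine hg.unique ?_
    have := hasSum_single (f := fun j => (ζ ⟨lam j, mem_range_self j⟩ *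
        (Pi.single k 1 : ℕ → ℝ) j) • h1val (e j)) k
      fun j hj => by rw [hz j hj, mul_zero, zero_smul]
    simpa only [Pi.single_eq_same, mul_one] using this
  have h3 := hψ (e k)
  rw [h1, h2, real_inner_smul_left, he.inner_self, mul_one] at h3
  exact h3.symm

variable [IsFiniteMeasure (surfaceMeasure Γ)]

/-- The symbol `lam_k ↦ ⟨𝒢_Γ e_k, e_k⟩`. -/
def symbol (c : Coefficients) (e : ℕ → H1 Γ) (lam : ℕ → ℝ) (x : range lam) : ℝ :=
  propagation c (e x.2.choose) (e x.2.choose)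

theorem propagation_basis (hΓ : IsClosedHypersurface Γ) (hc : c.Admissible)
    (he : IsEigenbasis e lam) (k : ℕ) (ψ : H1 Γ) :
    propagation c (e k) ψ = propagation c (e k) (e k) * ⟪h1val (e k), h1val ψ⟫_ℝ :=
  propagation_eigen hΓ hc (he.pos k).ne' (he.eigen k) (he.eigen k) (he.inner_self k) ψ

theorem symbol_apply (hΓ : IsClosedHypersurface Γ) (hc : c.Admissible)
    (he : IsEigenbasis e lam) (k : ℕ) :
    symbol c e lam ⟨lam k, mem_range_self k⟩ = propagation c (e k) (e k) := by
  -- The chosen index may differ from k, but it has the same eigenvalue, which is all that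
  -- `propagation_eigen` needs.
  have hj := (mem_range_self (f := lam) k).choose_spec
  set j := (mem_range_self (f := lam) k).choose
  have h1 := he.eigen j
  rw [hj] at h1
  have h := propagation_eigen hΓ hc (he.pos k).ne' h1 (he.eigen k) (he.inner_self j) (e k)
  rw [he.inner_self, mul_one] at h
  exact h.symm

theorem propagation_basis_pos (hΓ : IsClosedHypersurface Γ) (hc : c.Admissible)
    (he : IsEigenbasis e lam) (k : ℕ) : 0 < propagation c (e k) (e k) :=
  propagation_pos hΓ hc (he.pos k).ne' (he.eigen k) (he.inner_self k)

theorem isSpectralSymbol_symbol (hΓ : IsClosedHypersurface Γ) (hc : c.Admissible)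
    (he : IsEigenbasis e lam) : IsSpectralSymbol c e lam (symbol c e lam) := by
  intro a ha
  obtain ⟨h, hh⟩ := he.summable_h1 ha
  -- The linear growth of the symbol is exactly absorbed by the assumed weight λ_k².
  have hsum : Summable fun k => (symbol c e lam ⟨lam k, mem_range_self k⟩ * a k) ^ 2 := by
    refine Summable.of_nonneg_of_le (fun k => sq_nonneg _) (fun k => ?_)
      (ha.mul_left ((sigma * ‖halfSqrtSm hc‖ ^ 2) ^ 2))
    have hp := propagation_basis_pos hΓ hc he k
    have hle := propagation_le hc (he.pos k).le (he.eigen k) (he.inner_self k) hp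
    rw [symbol_apply hΓ hc he, mul_pow, ← mul_assoc, ← mul_pow (sigma * ‖halfSqrtSm hc‖ ^ 2)]
    exact mul_le_mul_of_nonneg_right (pow_le_pow_left₀ hp.le hle 2) (sq_nonneg _)
  obtain ⟨g, hg⟩ := summable_smul_orthonormal he.orthonormal hsum
  refine ⟨h, hh, g, hg, fun ψ => ?_⟩
  obtain ⟨L, hL⟩ := exists_propagation_eq hc ψ
  have h1 : HasSum (fun k => a k * propagation c (e k) ψ) (propagation c h ψ) := by
    rw [hL]
    refine (hh.mapL L).congr_fun fun k => ?_
    rw [map_smul, smul_eq_mul, hL]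
  have h2 := hg.mapL (innerSL ℝ (h1val ψ))
  refine h1.unique ?_
  rw [real_inner_comm]
  refine h2.congr_fun fun k => ?_
  rw [propagation_basis hΓ hc he k ψ, ← symbol_apply hΓ hc he k, innerSL_apply_apply,
    real_inner_smul_right, real_inner_comm]
  ring

end Symbol

end PropagationOperator

end

open PropagationOperator in
theorem lemma5p3 (d : ℕ) (hd : 2 ≤ d) (Γ : Set (Eu d)) (hΓ : IsClosedHypersurface Γ)
    (c : Coefficients) (hc : c.Admissible)
    (e : ℕ → H1 Γ) (lam : ℕ → ℝ) (he : IsEigenbasis e lam) :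
    -- the solution operator and the functions in `H` are well defined
    (∀ κ : H1 Γ, ∃! p : EnergySpace Γ c × StrongDual ℝ (H1 Γ), IsSolution κ p) ∧
    (∀ f : EnergySpace Γ c, ∃! g : CylL2 Γ, IsRealisation f g) ∧
    -- orthogonality
    (∀ k l, k ≠ l → ∀ᵐ u ∂(volume.restrict (Ioo (-1 : ℝ) 1)), coeffF c (e k) (e l) u = 0) ∧
    -- spectral representation
    ∃ ζ : range lam → ℝ, (∀ x, 0 < ζ x) ∧
      IsSpectralSymbol c e lam ζ ∧
      (∀ k, ζ ⟨lam k, mem_range_self k⟩ = propagation c (e k) (e k) ∧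
        IntervalIntegrable (fun u => c.sm u * coeffF c (e k) (e k) u) volume (-1) 1 ∧
        propagation c (e k) (e k)
          = 1 / 2 * lam k * ∫ u in (-1 : ℝ)..1, c.sm u * coeffF c (e k) (e k) u) ∧
      ∀ ζ' : range lam → ℝ, IsSpectralSymbol c e lam ζ' → ζ' = ζ := by
  have := hΓ.isFiniteMeasure
  refine ⟨existsUnique_isSolution hc, existsUnique_isRealisation hΓ hc, fun k l hkl => ?_,
    symbol c e lam, fun x => propagation_basis_pos hΓ hc he _,
    isSpectralSymbol_symbol hΓ hc he, fun k => ⟨symbol_apply hΓ hc he k,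
      intervalIntegrable_and_propagation_eq hΓ hc (he.eigen k) (he.pos k).ne'⟩, ?_⟩
  · exact ae_restrict_of_ae_restrict_of_subset Ioo_subset_Icc_self
      (coeffF_eq_zero hΓ hc (he.pos k).ne' (he.eigen k) (he.inner_self k) (he.inner_ne hkl.symm))
  · rintro ζ' hζ'
    funext ⟨_, k, rfl⟩
    exact (hζ'.apply he k).trans (symbol_apply hΓ hc he k).symm
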